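/- For $N\ge 0$ let $Q_N$ be the hypercube graph on $\{0,1\}^N$ (two vertices are adjacent iff they differ in exactly one coordinate), and for $0\le k\le 2^N$ let the initial segment $I_k\subseteq Q_N$ be the set of the vertices $x_0x_1\cdots x_{N-1}$ that, read as binary representations of natural numbers, are less than $k$. A pair $(a,b)$ of positive integers is called \emph{fit} if for every $N$ with $2^N\ge a+b$ there exist graph automorphisms $g_1,g_2\in\mathrm{Aut}(Q_N)$ such that $g_1(I_a)\cup g_2(I_b)=I_{a+b}$ in $Q_N$; otherwise $(a,b)$ is called \emph{unfit}. \textbf{Theorem.} Let $t_n$ be the number of unfit pairs $(a,b)$ of integers with $0<a,b\le 2^n$. Then for every $n\ge 4$, $$t_n = 4^n-\binom43 3^n+\binom42 2^n-\binom41 = 4^n-4\cdot 3^n+6\cdot 2^n-4,$$ and this is the number of surjections from an $n$-element set onto a $4$-element set. -/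

import Mathlib

/-- The hypercube graph `Q_n` on `{0,1}^n`: two vertices are adjacent iff they differ in exactly
one coordinate. -/
def hypercube (n : ℕ) : SimpleGraph (Fin n → Bool) where
  Adj x y := hammingDist x y = 1
  symm := ⟨fun x y h => by rw [hammingDist_comm]; exact h⟩
  loopless := ⟨fun x h => by simp at h⟩

/-- The natural number whose binary representation is `x_0 x_1 … x_{n-1}`
(`x_0` is the most significant digit). -/
def binaryValue {n : ℕ} (x : Fin n → Bool) : ℕ :=
  ∑ i : Fin n, (x i).toNat * 2 ^ (n - 1 - (i : ℕ))

/-- The initial segment `I_a ⊆ Q_n`: the vertices preceding `a` in the binary order. It has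
exactly `a` elements when `a ≤ 2 ^ n`. -/
def initialSegment (n a : ℕ) : Set (Fin n → Bool) :=
  {x | binaryValue x < a}

/-- `(a, b)` is fit if in every hypercube `Q_N` with `a + b ≤ 2 ^ N` there are automorphisms
`g₁`, `g₂` of the graph `Q_N` with `g₁(I_a) ∪ g₂(I_b) = I_{a+b}`. -/
def Fit (a b : ℕ) : Prop :=
  ∀ N : ℕ, a + b ≤ 2 ^ N →
    ∃ g₁ g₂ : hypercube N ≃g hypercube N,
      g₁ '' initialSegment N a ∪ g₂ '' initialSegment N b = initialSegment N (a + b)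

/-- A pair is unfit if it is not fit. -/
def Unfit (a b : ℕ) : Prop := ¬ Fit a b

/-- `t_n`: the number of unfit pairs `(a, b)` of integers with `0 < a, b ≤ 2 ^ n`. -/
noncomputable def unfitCount (n : ℕ) : ℕ :=
  {p : ℕ × ℕ | (0 < p.1 ∧ p.1 ≤ 2 ^ n) ∧ (0 < p.2 ∧ p.2 ≤ 2 ^ n) ∧ Unfit p.1 p.2}.ncard

/-! ### Automorphisms and coordinates -/

/-- The vertex obtained from `x` by switching its coordinate `j`. -/
def flipAt {n : ℕ} (j : Fin n) (x : Fin n → Bool) : Fin n → Bool :=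
  Function.update x j (!x j)

lemma flipAt_self {n : ℕ} (j : Fin n) (x : Fin n → Bool) : flipAt j x j = !x j := by
  simp [flipAt]

lemma flipAt_of_ne {n : ℕ} {j k : Fin n} (h : k ≠ j) (x : Fin n → Bool) : flipAt j x k = x k := by
  simp [flipAt, h]

lemma flipAt_flipAt {n : ℕ} (j : Fin n) (x : Fin n → Bool) : flipAt j (flipAt j x) = x := by
  simp [flipAt]

lemma flipAt_comm {n : ℕ} (j k : Fin n) (x : Fin n → Bool) :
    flipAt j (flipAt k x) = flipAt k (flipAt j x) := by
  ext i
  by_cases hjk : j = k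
  · rw [hjk]
  · by_cases hj : i = j
    · subst hj
      rw [flipAt_self, flipAt_of_ne hjk, flipAt_of_ne hjk, flipAt_self]
    · rw [flipAt_of_ne hj]
      by_cases hk : i = k
      · subst hk
        rw [flipAt_self, flipAt_self, flipAt_of_ne hj]
      · rw [flipAt_of_ne hk, flipAt_of_ne hk, flipAt_of_ne hj]

lemma flipAt_left_injective {n : ℕ} {j k : Fin n} {x : Fin n → Bool}
    (h : flipAt j x = flipAt k x) : j = k := by
  by_contra hne
  have := congrFun h j
  rw [flipAt_self, flipAt_of_ne hne] at this
  simp at this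

lemma hypercube_adj_iff {n : ℕ} {x y : Fin n → Bool} :
    (hypercube n).Adj x y ↔ ∃ j, y = flipAt j x := by
  change hammingDist x y = 1 ↔ _
  unfold hammingDist
  rw [Finset.card_eq_one]
  constructor
  · rintro ⟨j, hj⟩
    refine ⟨j, ?_⟩
    ext i
    have hi := Finset.ext_iff.1 hj i
    simp only [Finset.mem_filter, Finset.mem_univ, true_and, Finset.mem_singleton] at hi
    by_cases hij : i = j
    · subst hij
      rw [flipAt_self]
      have := hi.2 rfl
      revert this
      cases x i <;> cases y i <;> simp
    · rw [flipAt_of_ne hij]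
      by_contra hne
      exact hij (hi.1 fun h => hne h.symm)
  · rintro ⟨j, rfl⟩
    refine ⟨j, ?_⟩
    ext i
    simp only [Finset.mem_filter, Finset.mem_univ, true_and, Finset.mem_singleton]
    by_cases hij : i = j
    · subst hij
      simp [flipAt_self]
    · simp [flipAt_of_ne hij, hij]

/-- A function on the cube that is invariant under all coordinate switches is constant. -/
lemma eq_of_flipAt_invariant {n : ℕ} {α : Type*} {f : (Fin n → Bool) → α}
    (hf : ∀ k x, f (flipAt k x) = f x) (x y : Fin n → Bool) : f x = f y := by
  have key : ∀ S : Finset (Fin n), f (S.piecewise y x) = f x := by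
    intro S
    induction S using Finset.induction_on with
    | empty => simp
    | insert k S hk ih =>
      rw [Finset.piecewise_insert, ← ih]
      by_cases h : y k = S.piecewise y x k
      · rw [h, Function.update_eq_self]
      · rw [← hf k (S.piecewise y x)]
        congr 1
        unfold flipAt
        congr 1
        revert h
        cases y k <;> cases S.piecewise y x k <;> simp
  simpa using (key Finset.univ).symm

/-- An automorphism of the cube turns a coordinate into a coordinate, up to negation. -/
theorem exists_coord_of_iso {n : ℕ} (g : hypercube n ≃g hypercube n) (j : Fin n) :
    ∃ (j' : Fin n) (e : Bool), ∀ x, g x j' = xor (x j) e := by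
  have hadj : ∀ k x, ∃ d, g (flipAt k x) = flipAt d (g x) := fun k x =>
    hypercube_adj_iff.1 (g.map_adj_iff.2 (hypercube_adj_iff.2 ⟨k, rfl⟩))
  -- `d k x` is the direction of the image of the edge at `x` in direction `k`.
  choose d hd using hadj
  have hne : ∀ {k l : Fin n} (x), k ≠ l → d k x ≠ d l x := by
    intro k l x hkl h
    have h1 := hd k x
    rw [h, ← hd l x] at h1
    exact hkl (flipAt_left_injective (g.injective h1))
  have hne' : ∀ {k l : Fin n} (x), k ≠ l → d k (flipAt l x) ≠ d l x := by
    intro k l x hkl h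
    have h1 := hd k (flipAt l x)
    rw [hd l x, h, flipAt_flipAt] at h1
    have h2 := congrArg (flipAt k) (g.injective h1)
    rw [flipAt_flipAt] at h2
    exact hkl (flipAt_left_injective h2).symm
  -- For `k = j` this is the same edge read from its other end; for `k ≠ j`, opposite edges of a
  -- square go to opposite edges of a square.
  have hconst : ∀ k x, d j (flipAt k x) = d j x := by
    intro k x
    by_cases hkj : k = j
    · subst hkj
      have h1 := hd k (flipAt k x)
      rw [hd k x, flipAt_flipAt] at h1
      have h2 := congrArg (flipAt (d k (flipAt k x))) h1
      rw [flipAt_flipAt] at h2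
      exact flipAt_left_injective h2
    · have h1 := hd j (flipAt k x)
      rw [flipAt_comm, hd k (flipAt j x), hd j x, hd k x] at h1
      by_contra hcon
      have h2 := congrFun h1 (d j x)
      rw [flipAt_of_ne (hne' x hkj).symm, flipAt_self, flipAt_of_ne (Ne.symm hcon),
        flipAt_of_ne (hne x (Ne.symm hkj))] at h2
      simp at h2
  have hd' : ∀ x, d j x = d j (fun _ => false) := fun x => eq_of_flipAt_invariant hconst _ _
  refine ⟨d j (fun _ => false), g (fun _ => false) (d j (fun _ => false)), fun x => ?_⟩
  -- The image coordinate changes exactly when coordinate `j` does, so their xor is constant; its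
  -- value at the zero vertex is the sign `e`.
  have hinv : ∀ k x, xor (g (flipAt k x) (d j (fun _ => false))) (flipAt k x j) =
      xor (g x (d j (fun _ => false))) (x j) := by
    intro k x
    by_cases hkj : k = j
    · subst hkj
      rw [hd k x, ← hd' x, flipAt_self, flipAt_self]
      simp
    · rw [hd k x, ← hd' x, flipAt_of_ne (hne x (Ne.symm hkj)), flipAt_of_ne (Ne.symm hkj)]
  have h := eq_of_flipAt_invariant
    (f := fun x => xor (g x (d j (fun _ => false))) (x j)) hinv x (fun _ => false)
  rw [Bool.xor_false] at h
  rw [← h]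
  cases g x (d j fun _ => false) <;> cases x j <;> rfl

/-! ### Passing between the cube and its half cubes -/

lemma hammingDist_insertNth {n : ℕ} (j : Fin (n + 1)) (b c : Bool) (x y : Fin n → Bool) :
    hammingDist (j.insertNth b x : Fin (n + 1) → Bool) (j.insertNth c y) =
      (if b = c then 0 else 1) + hammingDist x y := by
  unfold hammingDist
  rw [Finset.card_filter, Finset.card_filter, Fin.sum_univ_succAbove _ j]
  simp

/-- An automorphism of the cube restricts to an isomorphism from any half cube onto a half cube. -/
theorem exists_restrict_iso {n : ℕ} (g : hypercube (n + 1) ≃g hypercube (n + 1)) (j : Fin (n + 1))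
    (b : Bool) : ∃ (j' : Fin (n + 1)) (b' : Bool) (h : hypercube n ≃g hypercube n),
      ∀ y : Fin n → Bool, g (j.insertNth b y) = j'.insertNth b' (h y) := by
  obtain ⟨j', e, hj⟩ := exists_coord_of_iso g j
  have h1 : ∀ y : Fin n → Bool, j'.insertNth (xor b e) (j'.removeNth (g (j.insertNth b y))) =
      g (j.insertNth b y) := by
    intro y
    have : xor b e = g (j.insertNth b y) j' := by rw [hj]; simp
    rw [this, Fin.insertNth_self_removeNth]
  have h2 : ∀ y : Fin n → Bool, j.insertNth b (j.removeNth (g.symm (j'.insertNth (xor b e) y))) =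
      g.symm (j'.insertNth (xor b e) y) := by
    intro y
    have h := hj (g.symm (j'.insertNth (xor b e) y))
    rw [RelIso.apply_symm_apply, Fin.insertNth_apply_same] at h
    have : b = g.symm (j'.insertNth (xor b e) y) j := by
      revert h
      cases b <;> cases e <;> cases g.symm (j'.insertNth _ y) j <;> simp
    conv_lhs => enter [2]; rw [this]
    rw [Fin.insertNth_self_removeNth]
  refine ⟨j', xor b e, ⟨⟨fun y => j'.removeNth (g (j.insertNth b y)),
    fun y => j.removeNth (g.symm (j'.insertNth (xor b e) y)), fun y => ?_, fun y => ?_⟩, ?_⟩, ?_⟩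
  · simp only [h1, RelIso.symm_apply_apply, Fin.removeNth_insertNth]
  · simp only [h2, RelIso.apply_symm_apply, Fin.removeNth_insertNth]
  · intro x y
    change hammingDist (j'.removeNth (g (j.insertNth b x))) (j'.removeNth (g (j.insertNth b y))) = 1
      ↔ hammingDist x y = 1
    have h3 := hammingDist_insertNth j' (xor b e) (xor b e)
      (j'.removeNth (g (j.insertNth b x))) (j'.removeNth (g (j.insertNth b y)))
    rw [h1, h1, if_pos rfl, zero_add] at h3
    rw [← h3]
    have h4 := g.map_adj_iff (v := j.insertNth b x) (w := j.insertNth b y)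
    change hammingDist _ _ = 1 ↔ hammingDist _ _ = 1 at h4
    rw [h4, hammingDist_insertNth, if_pos rfl, zero_add]
  · exact fun y => (h1 y).symm

/-- The automorphism of `Q_{n+1}` that acts as `h` on all coordinates but the first and
moves the first coordinate, with its sign changed according to `b`, to position `j`. -/
def insertIso {n : ℕ} (h : hypercube n ≃g hypercube n) (j : Fin (n + 1)) (b : Bool) :
    hypercube (n + 1) ≃g hypercube (n + 1) where
  toFun x := j.insertNth (xor (x 0) b) (h (Fin.tail x))
  invFun x := Fin.cons (xor (x j) b) (h.symm (j.removeNth x))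
  left_inv x := by simp
  right_inv x := by simp
  map_rel_iff' := by
    intro x y
    change hammingDist _ _ = 1 ↔ hammingDist x y = 1
    simp only [Equiv.coe_fn_mk]
    have h1 := h.map_adj_iff (v := Fin.tail x) (w := Fin.tail y)
    change hammingDist _ _ = 1 ↔ hammingDist _ _ = 1 at h1
    have h2 := hammingDist_insertNth 0 (x 0) (y 0) (Fin.tail x) (Fin.tail y)
    rw [Fin.insertNth_zero', Fin.insertNth_zero', Fin.cons_self_tail, Fin.cons_self_tail] at h2
    rw [h2, hammingDist_insertNth]
    by_cases hxy : x 0 = y 0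
    · simpa [hxy] using h1
    · have h3 : ¬ (xor (x 0) b = xor (y 0) b) := by simpa using hxy
      rw [if_neg hxy, if_neg h3]
      have h4 : ∀ u v : Fin n → Bool, 1 + hammingDist u v = 1 ↔ u = v := by
        intro u v
        rw [← hammingDist_eq_zero]
        omega
      rw [h4, h4]
      exact h.injective.eq_iff

/-- The antipodal automorphism of the cube. -/
def notIso (n : ℕ) : hypercube n ≃g hypercube n where
  toFun x := fun i => !x i
  invFun x := fun i => !x i
  left_inv x := by simp
  right_inv x := by simp
  map_rel_iff' := by
    intro x y
    change hammingDist _ _ = 1 ↔ hammingDist x y = 1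
    simp [hammingDist]

/-! ### Binary values and digit counts -/

lemma binaryValue_cons {n : ℕ} (b : Bool) (x : Fin n → Bool) :
    binaryValue (Fin.cons b x : Fin (n + 1) → Bool) = b.toNat * 2 ^ n + binaryValue x := by
  unfold binaryValue
  rw [Fin.sum_univ_succ]
  congr 1
  refine Finset.sum_congr rfl fun i _ => ?_
  rw [Fin.cons_succ, Fin.val_succ]
  congr 2
  omega

lemma binaryValue_lt {n : ℕ} (x : Fin n → Bool) : binaryValue x < 2 ^ n := by
  induction n with
  | zero => simp [binaryValue]
  | succ n ih =>
    rw [← Fin.cons_self_tail x, binaryValue_cons, pow_succ]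
    have := ih (Fin.tail x)
    have := Bool.toNat_le (x 0)
    nlinarith

lemma binaryValue_not {n : ℕ} (x : Fin n → Bool) :
    binaryValue (fun i => !x i) + binaryValue x + 1 = 2 ^ n := by
  induction n with
  | zero => simp [binaryValue]
  | succ n ih =>
    have h1 : (fun i => !x i) = (Fin.cons (!x 0) (fun i => !Fin.tail x i) : Fin (n + 1) → Bool) := by
      ext i
      refine Fin.cases ?_ (fun i => ?_) i <;> simp [Fin.tail]
    conv_lhs => rw [h1, ← Fin.cons_self_tail x]
    rw [binaryValue_cons, binaryValue_cons, pow_succ]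
    have := ih (Fin.tail x)
    cases x 0 <;> simp <;> omega

lemma binaryValue_injective (n : ℕ) : Function.Injective (binaryValue (n := n)) := by
  induction n with
  | zero => exact fun x y _ => Subsingleton.elim x y
  | succ n ih =>
    intro x y h
    rw [← Fin.cons_self_tail x, ← Fin.cons_self_tail y] at h ⊢
    rw [binaryValue_cons, binaryValue_cons] at h
    have hx := binaryValue_lt (Fin.tail x)
    have hy := binaryValue_lt (Fin.tail y)
    cases hx0 : x 0 <;> cases hy0 : y 0 <;> simp [hx0, hy0] at h ⊢ <;>
      first | omega | exact ih h

lemma ncard_initialSegment {n a : ℕ} (ha : a ≤ 2 ^ n) : (initialSegment n a).ncard = a := by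
  have hinj : Function.Injective (fun x : Fin n → Bool => (⟨binaryValue x, binaryValue_lt x⟩ : Fin (2 ^ n))) :=
    fun x y h => binaryValue_injective n (Fin.mk.inj h)
  have hbij := (Fintype.bijective_iff_injective_and_card _).2 ⟨hinj, by simp⟩
  have himg : binaryValue '' initialSegment n a = Set.Iio a := by
    ext v
    constructor
    · rintro ⟨x, hx, rfl⟩
      exact hx
    · intro hv
      obtain ⟨x, hx⟩ := hbij.2 ⟨v, lt_of_lt_of_le hv ha⟩
      have hx' : binaryValue x = v := congrArg Fin.val hx
      exact ⟨x, by simpa [initialSegment, hx'] using hv, hx'⟩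
  rw [← Set.ncard_image_of_injective _ (binaryValue_injective n), himg]
  simp [Set.ncard_eq_toFinset_card']

/-- Inserting a digit above the last `n - j` digits. -/
lemma binaryValue_insertNth {n : ℕ} (j : Fin (n + 1)) (b : Bool) (y : Fin n → Bool) :
    ∃ hi lo : ℕ, lo < 2 ^ (n - j) ∧ binaryValue y = hi * 2 ^ (n - j) + lo ∧
      binaryValue (j.insertNth b y : Fin (n + 1) → Bool) =
        hi * 2 ^ (n - j + 1) + b.toNat * 2 ^ (n - j) + lo := by
  induction n with
  | zero =>
    obtain rfl : j = 0 := Fin.fin_one_eq_zero j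
    refine ⟨0, 0, by simp, by simp [binaryValue], ?_⟩
    rw [Fin.insertNth_zero', binaryValue_cons]
    simp [binaryValue]
  | succ n ih =>
    refine Fin.cases ?_ (fun j => ?_) j
    · refine ⟨0, binaryValue y, by simpa using binaryValue_lt y, by simp, ?_⟩
      rw [Fin.insertNth_zero', binaryValue_cons]
      simp
    · obtain ⟨hi, lo, h1, h2, h3⟩ := ih j (Fin.tail y)
      have hj : n + 1 - (j.succ : ℕ) = n - j := by simp
      have hins : (j.succ.insertNth b y : Fin (n + 2) → Bool) =
          Fin.cons (y 0) (j.insertNth b (Fin.tail y)) := by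
        conv_lhs => rw [← Fin.cons_self_tail y]
        ext i
        refine Fin.cases ?_ (fun i => ?_) i
        · rw [Fin.cons_zero, ← Fin.succ_succAbove_zero j, Fin.insertNth_apply_succAbove,
            Fin.cons_zero]
        · rw [Fin.cons_succ]
          refine Fin.succAboveCases j ?_ (fun i => ?_) i
          · simp
          · rw [← Fin.succ_succAbove_succ, Fin.insertNth_apply_succAbove, Fin.cons_succ,
              Fin.insertNth_apply_succAbove]
      have hpow : 2 ^ n = 2 ^ (j : ℕ) * 2 ^ (n - j) := by
        rw [← pow_add]
        congr 1
        omega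
      refine ⟨(y 0).toNat * 2 ^ (j : ℕ) + hi, lo, by rwa [hj], ?_, ?_⟩
      · conv_lhs => rw [← Fin.cons_self_tail y]
        rw [binaryValue_cons, h2, hj, hpow]
        ring
      · rw [hins, binaryValue_cons, h3, hj, pow_succ, pow_succ, hpow]
        ring

/-- The number of naturals below `c` whose binary digit at position `p` is `b`. -/
def digitCount (p : ℕ) (b : Bool) (c : ℕ) : ℕ :=
  c / 2 ^ (p + 1) * 2 ^ p + (if b then c % 2 ^ (p + 1) - 2 ^ p else min (c % 2 ^ (p + 1)) (2 ^ p))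

lemma digitCount_true_add_false (p c : ℕ) : digitCount p true c + digitCount p false c = c := by
  have h := Nat.div_add_mod c (2 ^ (p + 1))
  have h2 := Nat.mod_lt c (pow_pos two_pos (p + 1) : 0 < 2 ^ (p + 1))
  simp only [digitCount, if_true, Bool.false_eq_true, if_false]
  generalize c % 2 ^ (p + 1) = r at *
  rw [pow_succ] at *
  have : 2 ^ p * 2 * (c / (2 ^ p * 2)) = 2 * (c / (2 ^ p * 2) * 2 ^ p) := by ring
  omega

/-- Deleting a coordinate with fixed value preserves the binary order, so only the size has to be
found. The position is `n - j` because coordinate `0` is the most significant digit. -/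
lemma insertNth_preimage_initialSegment {n : ℕ} (j : Fin (n + 1)) (b : Bool) (a : ℕ) :
    {y : Fin n → Bool | (j.insertNth b y : Fin (n + 1) → Bool) ∈ initialSegment (n + 1) a} =
      initialSegment n (digitCount (n - j) b a) := by
  ext y
  obtain ⟨hi, lo, h1, h2, h3⟩ := binaryValue_insertNth j b y
  simp only [initialSegment, Set.mem_ofPred_eq, h2, h3, digitCount]
  have h := Nat.div_add_mod a (2 ^ (n - j + 1))
  have hr := Nat.mod_lt a (pow_pos two_pos (n - j + 1) : 0 < 2 ^ (n - j + 1))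
  generalize a % 2 ^ (n - j + 1) = r at *
  generalize a / 2 ^ (n - j + 1) = q at *
  rw [← h]
  rw [pow_succ] at *
  generalize 2 ^ (n - (j : ℕ)) = P at *
  have e1 : P * 2 * q = 2 * (q * P) := by ring
  have e2 : hi * (P * 2) = 2 * (hi * P) := by ring
  rw [e1, e2]
  rcases lt_trichotomy hi q with hq | hq | hq
  · have : (hi + 1) * P ≤ q * P := Nat.mul_le_mul_right _ hq
    rw [add_mul] at this
    cases b <;> simp <;> omega
  · subst hq
    cases b <;> simp <;> omega
  · have : (q + 1) * P ≤ hi * P := Nat.mul_le_mul_right _ hq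
    rw [add_mul] at this
    cases b <;> simp <;> omega

/-! ### Segments: complements, slices, half cubes -/

/-- `A` is the image of the initial segment of size `a` under an automorphism of the cube. -/
def IsSegment {n : ℕ} (a : ℕ) (A : Set (Fin n → Bool)) : Prop :=
  ∃ g : hypercube n ≃g hypercube n, g '' initialSegment n a = A

/-- The part of `A` in the half cube where coordinate `j` equals `b`. -/
def slice {n : ℕ} (j : Fin (n + 1)) (b : Bool) (A : Set (Fin (n + 1) → Bool)) :
    Set (Fin n → Bool) :=
  {y | (j.insertNth b y : Fin (n + 1) → Bool) ∈ A}

namespace IsSegment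

variable {n a : ℕ}

lemma image {A : Set (Fin n → Bool)} (h : IsSegment a A) (g : hypercube n ≃g hypercube n) :
    IsSegment a (g '' A) := by
  obtain ⟨g', rfl⟩ := h
  exact ⟨g'.trans g, by rw [← Set.image_comp]; rfl⟩

lemma ncard_eq {A : Set (Fin n → Bool)} (h : IsSegment a A) (ha : a ≤ 2 ^ n) : A.ncard = a := by
  obtain ⟨g, rfl⟩ := h
  rw [Set.ncard_image_of_injective _ g.injective, ncard_initialSegment ha]

/-- The antipodal map reverses the binary order, hence exchanges initial and final segments. -/
lemma compl {A : Set (Fin n → Bool)} (h : IsSegment a A) (ha : a ≤ 2 ^ n) :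
    IsSegment (2 ^ n - a) Aᶜ := by
  obtain ⟨g, rfl⟩ := h
  refine ⟨(notIso n).trans g, ?_⟩
  rw [← Set.image_compl_eq g.bijective]
  change (g ∘ notIso n) '' _ = _
  rw [Set.image_comp]
  congr 1
  ext x
  constructor
  · rintro ⟨y, hy, rfl⟩
    have := binaryValue_not y
    simp only [initialSegment, Set.mem_ofPred_eq, Set.mem_compl_iff] at hy ⊢
    change ¬ binaryValue (fun i => !y i) < a
    omega
  · intro hx
    have := binaryValue_not x
    refine ⟨fun i => !x i, ?_, (notIso n).left_inv x⟩
    simp only [initialSegment, Set.mem_ofPred_eq, Set.mem_compl_iff] at hx ⊢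
    omega

/-- A segment splits along every coordinate as an initial segment does along a binary digit. -/
theorem exists_slice {A : Set (Fin (n + 1) → Bool)} (h : IsSegment a A) (j : Fin (n + 1))
    (b : Bool) : ∃ (p : ℕ) (b' : Bool), p ≤ n ∧ IsSegment (digitCount p b' a) (slice j b A) := by
  obtain ⟨g, rfl⟩ := h
  obtain ⟨j', b', h, hh⟩ := exists_restrict_iso g.symm j b
  refine ⟨n - j', b', Nat.sub_le _ _, h.symm, ?_⟩
  rw [← insertNth_preimage_initialSegment]
  ext y
  constructor
  · rintro ⟨z, hz, rfl⟩
    refine ⟨j'.insertNth b' z, hz, ?_⟩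
    rw [← g.symm.injective.eq_iff, hh, RelIso.symm_apply_apply, RelIso.apply_symm_apply]
  · rintro ⟨z, hz, hzy⟩
    refine ⟨h y, ?_, h.symm_apply_apply y⟩
    change (j'.insertNth b' (h y) : Fin (n + 1) → Bool) ∈ initialSegment (n + 1) a
    rw [← hh, ← hzy, RelIso.symm_apply_apply]
    exact hz

/-- A segment of a half cube is a segment of the cube. -/
theorem insert {A : Set (Fin n → Bool)} (h : IsSegment a A) (ha : a ≤ 2 ^ n) (j : Fin (n + 1))
    (b : Bool) : IsSegment a {x : Fin (n + 1) → Bool | x j = b ∧ j.removeNth x ∈ A} := by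
  obtain ⟨g, rfl⟩ := h
  refine ⟨insertIso g j b, ?_⟩
  ext x
  have hmem : ∀ z : Fin (n + 1) → Bool, z ∈ initialSegment (n + 1) a ↔
      z 0 = false ∧ Fin.tail z ∈ initialSegment n a := by
    intro z
    conv_lhs => rw [← Fin.cons_self_tail z]
    simp only [initialSegment, Set.mem_ofPred_eq, binaryValue_cons]
    cases z 0 <;> simp; omega
  constructor
  · rintro ⟨z, hz, rfl⟩
    obtain ⟨h0, h1⟩ := (hmem z).1 hz
    refine ⟨?_, Fin.tail z, h1, ?_⟩
    · simp [insertIso, h0]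
    · simp [insertIso]
  · rintro ⟨hb, z, hz, hzx⟩
    refine ⟨Fin.cons false z, (hmem _).2 ⟨rfl, by simpa using hz⟩, ?_⟩
    simp [insertIso, hzx, ← hb]

/-- A segment with at most half of the vertices lies in a half cube. -/
theorem exists_subset_half {A : Set (Fin (n + 1) → Bool)} (h : IsSegment a A) (ha : a ≤ 2 ^ n) :
    ∃ (j : Fin (n + 1)) (b : Bool), ∀ x ∈ A, x j = b := by
  obtain ⟨g, rfl⟩ := h
  obtain ⟨j, e, hj⟩ := exists_coord_of_iso g 0
  refine ⟨j, e, ?_⟩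
  rintro _ ⟨x, hx, rfl⟩
  rw [hj]
  -- Since `a ≤ 2 ^ n`, the leading digit vanishes on the initial segment; `g` carries that
  -- coordinate to `j`.
  have : x 0 = false := by
    rw [← Fin.cons_self_tail x] at hx
    simp only [initialSegment, Set.mem_ofPred_eq, binaryValue_cons] at hx
    cases h0 : x 0
    · rfl
    · rw [h0] at hx
      simp at hx
      omega
  simp [this]

end IsSegment

lemma isSegment_empty (n : ℕ) : IsSegment 0 (∅ : Set (Fin n → Bool)) :=
  ⟨RelIso.refl _, by simp [initialSegment]⟩

/-! ### Partitions into three segments -/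

/-- The cube `Q_n` can be partitioned into segments of sizes `a`, `b`, `c`. -/
def HasPartition (n a b c : ℕ) : Prop :=
  ∃ A B C : Set (Fin n → Bool), IsSegment a A ∧ IsSegment b B ∧ IsSegment c C ∧
    Disjoint A B ∧ Disjoint A C ∧ Disjoint B C ∧ ∀ x, x ∈ A ∨ x ∈ B ∨ x ∈ C

namespace HasPartition

variable {n a b c : ℕ}

lemma swap_left (h : HasPartition n a b c) : HasPartition n b a c := by
  obtain ⟨A, B, C, hA, hB, hC, hAB, hAC, hBC, hU⟩ := h
  exact ⟨B, A, C, hB, hA, hC, hAB.symm, hBC, hAC, fun x => by have := hU x; tauto⟩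

lemma swap_right (h : HasPartition n a b c) : HasPartition n a c b := by
  obtain ⟨A, B, C, hA, hB, hC, hAB, hAC, hBC, hU⟩ := h
  exact ⟨A, C, B, hA, hC, hB, hAC, hAB, hBC.symm, fun x => by have := hU x; tauto⟩

end HasPartition

/-- In `Q_n`, fitness of `(a, b)` amounts to a partition into three segments. -/
lemma hasPartition_iff_exists_iso {n a b : ℕ} (hab : a + b ≤ 2 ^ n) :
    HasPartition n a b (2 ^ n - (a + b)) ↔ ∃ g₁ g₂ : hypercube n ≃g hypercube n,
      g₁ '' initialSegment n a ∪ g₂ '' initialSegment n b = initialSegment n (a + b) := by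
  constructor
  · rintro ⟨A, B, C, ⟨g₁, rfl⟩, ⟨g₂, rfl⟩, hC, hAB, hAC, hBC, hU⟩
    have hC' := hC.compl (Nat.sub_le _ _)
    rw [Nat.sub_sub_self hab] at hC'
    -- The complement of `C` is a segment of size `a + b`; undoing its automorphism moves it to the
    -- standard position.
    obtain ⟨g, hg⟩ := hC'
    refine ⟨g₁.trans g.symm, g₂.trans g.symm, ?_⟩
    apply g.injective.image_injective
    rw [hg, Set.image_union]
    have e : ∀ (f : hypercube n ≃g hypercube n) (S : Set (Fin n → Bool)),
        g '' ((f.trans g.symm) '' S) = f '' S := by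
      intro f S
      rw [← Set.image_comp]
      refine Set.image_congr' fun x => ?_
      exact g.apply_symm_apply (f x)
    rw [e, e]
    ext x
    have h1 := hU x
    have h2 : x ∈ g₁ '' initialSegment n a → x ∉ C := fun h => Set.disjoint_left.1 hAC h
    have h3 : x ∈ g₂ '' initialSegment n b → x ∉ C := fun h => Set.disjoint_left.1 hBC h
    simp only [Set.mem_union, Set.mem_compl_iff]
    tauto
  · rintro ⟨g₁, g₂, h⟩
    refine ⟨_, _, (initialSegment n (a + b))ᶜ, ⟨g₁, rfl⟩, ⟨g₂, rfl⟩,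
      IsSegment.compl ⟨RelIso.refl _, ?_⟩ hab, ?_, ?_, ?_, fun x => ?_⟩
    · ext; simp
    -- The union has size `a + b`, so the two images cannot overlap.
    · have hcard := congrArg Set.ncard h
      rw [ncard_initialSegment hab] at hcard
      have h1 : (g₁ '' initialSegment n a).ncard = a := by
        rw [Set.ncard_image_of_injective _ g₁.injective, ncard_initialSegment (by omega)]
      have h2 : (g₂ '' initialSegment n b).ncard = b := by
        rw [Set.ncard_image_of_injective _ g₂.injective, ncard_initialSegment (by omega)]
      have h3 := Set.ncard_union_add_ncard_inter (g₁ '' initialSegment n a)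
        (g₂ '' initialSegment n b)
      rw [hcard, h1, h2] at h3
      rw [Set.disjoint_iff_inter_eq_empty, ← Set.ncard_eq_zero]
      omega
    · rw [← h]
      exact disjoint_compl_right.mono_left Set.subset_union_left |>.mono_right le_rfl
    · rw [← h]
      exact disjoint_compl_right.mono_left Set.subset_union_right
    · rw [← h]
      simp only [Set.mem_union, Set.mem_compl_iff]
      tauto

lemma ncard_add_ncard_add_ncard {n : ℕ} {A B C : Set (Fin n → Bool)} (hAB : Disjoint A B)
    (hAC : Disjoint A C) (hBC : Disjoint B C) (hU : ∀ x, x ∈ A ∨ x ∈ B ∨ x ∈ C) :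
    A.ncard + B.ncard + C.ncard = 2 ^ n := by
  rw [← Set.ncard_union_eq hAB, ← Set.ncard_union_eq (Set.disjoint_union_left.2 ⟨hAC, hBC⟩)]
  have : A ∪ B ∪ C = Set.univ := by
    ext x
    have := hU x
    simp only [Set.mem_union, Set.mem_univ, iff_true]
    tauto
  rw [this, Set.ncard_univ]
  simp

lemma ncard_slice_of_subset {n : ℕ} {j : Fin (n + 1)} {b : Bool} {A : Set (Fin (n + 1) → Bool)}
    (h : ∀ x ∈ A, x j = b) : (slice j b A).ncard = A.ncard := by
  rw [← Set.ncard_image_of_injective (slice j b A)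
    (Fin.insertNth_right_injective (α := fun _ => Bool) (x := b) (p := j))]
  congr 1
  ext x
  constructor
  · rintro ⟨y, hy, rfl⟩
    exact hy
  · intro hx
    have : (j.insertNth b (j.removeNth x) : Fin (n + 1) → Bool) = x := by
      rw [← h x hx, Fin.insertNth_self_removeNth]
    exact ⟨j.removeNth x, by rw [slice, Set.mem_ofPred_eq, this]; exact hx, this⟩

lemma disjoint_slice {n : ℕ} {j : Fin (n + 1)} {b : Bool} {A B : Set (Fin (n + 1) → Bool)}
    (h : Disjoint A B) : Disjoint (slice j b A) (slice j b B) :=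
  Set.disjoint_left.2 fun _ hA hB => Set.disjoint_left.1 h hA hB

lemma slice_eq_empty {n : ℕ} {j : Fin (n + 1)} {b : Bool} {A : Set (Fin (n + 1) → Bool)}
    (h : ∀ x ∈ A, x j = !b) : slice j b A = ∅ := by
  ext y
  simp only [slice, Set.mem_ofPred_eq, Set.mem_empty_iff_false, iff_false]
  intro hy
  have := h _ hy
  simp at this

lemma digitCount_le {p n : ℕ} (hp : p ≤ n) (b : Bool) {c : ℕ} (hc : c ≤ 2 ^ (n + 1)) :
    digitCount p b c ≤ 2 ^ n := by
  have h := insertNth_preimage_initialSegment (n := n) ⟨n - p, by omega⟩ b c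
  have hmono : digitCount p b c ≤ digitCount p b (2 ^ (n + 1)) ∧
      digitCount p b (2 ^ (n + 1)) = 2 ^ n := by
    have hpow : 2 ^ (n + 1) = 2 ^ (n - p) * 2 ^ (p + 1) := by
      rw [← pow_add]; congr 1; omega
    have hpow' : 2 ^ n = 2 ^ (n - p) * 2 ^ p := by
      rw [← pow_add]; congr 1; omega
    have hpos : 0 < 2 ^ (p + 1) := by positivity
    have e : digitCount p b (2 ^ (n + 1)) = 2 ^ n := by
      rw [digitCount, hpow, Nat.mul_div_cancel _ hpos, Nat.mul_mod_left, hpow']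
      cases b <;> simp
    refine ⟨?_, e⟩
    rw [e, digitCount]
    rw [hpow] at hc
    have h1 := Nat.div_add_mod c (2 ^ (p + 1))
    have hr := Nat.mod_lt c hpos
    rw [hpow']
    generalize c % 2 ^ (p + 1) = r at *
    generalize c / 2 ^ (p + 1) = q at *
    generalize 2 ^ (n - p) = K at *
    rw [pow_succ] at *
    generalize 2 ^ p = P at *
    rcases lt_or_ge q K with hq | hq
    · have := Nat.mul_le_mul_right P (Nat.succ_le_of_lt hq)
      rw [Nat.succ_mul] at this
      cases b <;> simp <;> omega
    · have h2 := Nat.mul_le_mul_right P hq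
      have h3 : P * 2 * q = 2 * (q * P) := by ring
      have h4 : K * (P * 2) = 2 * (K * P) := by ring
      cases b <;> simp <;> omega
  omega

namespace IsSegment

/-- Lets later arguments find the size of a slice by counting alone, without knowing the digit
position. -/
lemma slice_ncard {n a : ℕ} {A : Set (Fin (n + 1) → Bool)} (h : IsSegment a A)
    (ha : a ≤ 2 ^ (n + 1)) (j : Fin (n + 1)) (b : Bool) :
    IsSegment (slice j b A).ncard (slice j b A) := by
  obtain ⟨p, b', hp, h'⟩ := h.exists_slice j b
  rwa [h'.ncard_eq (digitCount_le hp b' ha)]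

end IsSegment

/-- The complement of the large part has at most `2 ^ n` vertices, so it lies in a half cube, which
then contains both other parts; slicing there loses only the opposite half, all of which belongs to
the large part. -/
theorem hasPartition_succ_iff {n a b c : ℕ} (hc : 2 ^ n ≤ c) (habc : a + b + c = 2 ^ (n + 1)) :
    HasPartition (n + 1) a b c ↔ HasPartition n a b (c - 2 ^ n) := by
  have hpow : 2 ^ (n + 1) = 2 ^ n + 2 ^ n := by ring
  constructor
  · rintro ⟨A, B, C, hA, hB, hC, hAB, hAC, hBC, hU⟩
    obtain ⟨j, b₀, hj⟩ := (hC.compl (by omega)).exists_subset_half (by omega)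
    have hAj : ∀ x ∈ A, x j = b₀ := fun x hx => hj x (Set.disjoint_left.1 hAC hx)
    have hBj : ∀ x ∈ B, x j = b₀ := fun x hx => hj x (Set.disjoint_left.1 hBC hx)
    have h1 := hA.slice_ncard (by omega) j b₀
    have h2 := hB.slice_ncard (by omega) j b₀
    have h3 := hC.slice_ncard (by omega) j b₀
    have hsum := ncard_add_ncard_add_ncard (disjoint_slice (j := j) (b := b₀) hAB)
      (disjoint_slice hAC) (disjoint_slice hBC) (fun x => hU _)
    have e1 := (ncard_slice_of_subset hAj).trans (hA.ncard_eq (by omega))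
    have e2 := (ncard_slice_of_subset hBj).trans (hB.ncard_eq (by omega))
    rw [e1, e2] at hsum
    rw [e1] at h1
    rw [e2] at h2
    rw [show (slice j b₀ C).ncard = c - 2 ^ n by omega] at h3
    exact ⟨_, _, _, h1, h2, h3, disjoint_slice hAB, disjoint_slice hAC, disjoint_slice hBC,
      fun x => hU _⟩
  · rintro ⟨A, B, C, hA, hB, hC, hAB, hAC, hBC, hU⟩
    -- The double complement enlarges `C` by the whole opposite half cube.
    have h3 := ((hC.compl (by omega)).insert (by omega) 0 true).compl (by omega)
    rw [show 2 ^ (n + 1) - (2 ^ n - (c - 2 ^ n)) = c by omega] at h3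
    refine ⟨_, _, _, hA.insert (by omega) 0 true, hB.insert (by omega) 0 true, h3, ?_, ?_, ?_, ?_⟩
    · exact Set.disjoint_left.2 fun x hx hy => Set.disjoint_left.1 hAB hx.2 hy.2
    · exact Set.disjoint_left.2 fun x hx hy => hy ⟨hx.1, Set.disjoint_left.1 hAC hx.2⟩
    · exact Set.disjoint_left.2 fun x hx hy => hy ⟨hx.1, Set.disjoint_left.1 hBC hx.2⟩
    · intro x
      have := hU (Fin.removeNth 0 x)
      simp only [Set.mem_ofPred_eq, Set.mem_compl_iff]
      tauto

/-! ### Closeness and the arithmetic criterion -/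

/-- `α` and `β` are the numbers of naturals below `α + β` with a given binary digit `0` and `1`,
in some order. -/
def Close (α β : ℕ) : Prop :=
  ∃ p : ℕ, (2 ^ p ∣ α ∨ 2 ^ p ∣ β) ∧ α ≤ β + 2 ^ p ∧ β ≤ α + 2 ^ p

lemma Close.symm {α β : ℕ} (h : Close α β) : Close β α := by
  obtain ⟨p, h1, h2, h3⟩ := h
  exact ⟨p, h1.symm, h3, h2⟩

lemma close_comm {α β : ℕ} : Close α β ↔ Close β α := ⟨Close.symm, Close.symm⟩

lemma close_zero_left (β : ℕ) : Close 0 β :=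
  ⟨β, Or.inl (dvd_zero _), Nat.zero_le _, by rw [zero_add]; exact Nat.lt_two_pow_self.le⟩

/-- In the last, incomplete block of length `2 ^ (p + 1)`, either no digit `1` occurs, so the count
of ones is a multiple of `2 ^ p`, or all zeros occur, so the count of zeros is. -/
lemma close_digitCount (p c : ℕ) : Close (digitCount p true c) (digitCount p false c) := by
  refine ⟨p, ?_, ?_, ?_⟩ <;> simp only [digitCount, if_true, Bool.false_eq_true, if_false]
  · rcases le_total (c % 2 ^ (p + 1)) (2 ^ p) with h | h
    · left
      rw [Nat.sub_eq_zero_of_le h]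
      simp
    · right
      rw [min_eq_right h]
      exact (Dvd.intro_left _ rfl).add dvd_rfl
  · have hr := Nat.mod_lt c (pow_pos two_pos (p + 1) : 0 < 2 ^ (p + 1))
    rw [pow_succ] at *
    omega
  · omega

lemma digitCount_of_lt {p q r : ℕ} (hr : r < 2 ^ (p + 1)) (b : Bool) :
    digitCount p b (q * 2 ^ (p + 1) + r) = q * 2 ^ p + (if b then r - 2 ^ p else min r (2 ^ p)) := by
  have h1 : (q * 2 ^ (p + 1) + r) / 2 ^ (p + 1) = q := by
    rw [add_comm, Nat.add_mul_div_right _ _ (by positivity), Nat.div_eq_of_lt hr, zero_add]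
  have h2 : (q * 2 ^ (p + 1) + r) % 2 ^ (p + 1) = r := by
    rw [add_comm, Nat.add_mul_mod_self_right, Nat.mod_eq_of_lt hr]
  rw [digitCount, h1, h2]

/-- Digit `0` always gets the larger count. If `2 ^ p` divides the smaller number, the last block
stops within its first half; otherwise it divides the larger one and the last block stops within its
second half. -/
lemma Close.exists_digitCount_of_le {α β : ℕ} (h : Close α β) (hle : β ≤ α) :
    ∃ p, digitCount p false (α + β) = α ∧ digitCount p true (α + β) = β := by
  obtain ⟨p, h1, h2, -⟩ := h
  have hlt : 2 ^ p < 2 ^ (p + 1) := by rw [pow_succ]; have : 0 < 2 ^ p := by positivity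
                                       omega
  by_cases hβ : 2 ^ p ∣ β
  · obtain ⟨q, rfl⟩ := hβ
    obtain ⟨s, rfl⟩ := Nat.exists_eq_add_of_le hle
    refine ⟨p, ?_⟩
    have e : 2 ^ p * q + s + 2 ^ p * q = q * 2 ^ (p + 1) + s := by ring
    rw [e, digitCount_of_lt (by omega), digitCount_of_lt (by omega)]
    simp only [if_true, Bool.false_eq_true, if_false]
    rw [mul_comm q]
    omega
  · obtain ⟨q, rfl⟩ := h1.resolve_right hβ
    cases q with
    | zero =>
      obtain rfl : β = 0 := by simpa using hle
      simp at hβ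
    | succ q =>
      refine ⟨p, ?_⟩
      rw [mul_add, mul_one] at *
      obtain ⟨s, rfl⟩ : ∃ s, β = 2 ^ p * q + s := Nat.exists_eq_add_of_le (by omega)
      rcases (show s ≤ 2 ^ p by omega).eq_or_lt with rfl | hs
      · exact absurd ((Dvd.intro _ rfl).add dvd_rfl) hβ
      · have e : 2 ^ p * q + 2 ^ p + (2 ^ p * q + s) = q * 2 ^ (p + 1) + (2 ^ p + s) := by ring
        have h3 : 2 ^ p + s < 2 ^ (p + 1) := by rw [pow_succ]; omega
        rw [e, digitCount_of_lt h3, digitCount_of_lt h3]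
        simp only [if_true, Bool.false_eq_true, if_false]
        rw [mul_comm q]
        omega

lemma digitCount_of_le {p c : ℕ} (hc : c ≤ 2 ^ p) (b : Bool) :
    digitCount p b c = if b then 0 else c := by
  have hlt : c < 2 ^ (p + 1) := by
    rw [pow_succ]; have : 0 < 2 ^ p := by positivity
    omega
  have := digitCount_of_lt (q := 0) hlt b
  rw [zero_mul, zero_mul, zero_add, zero_add] at this
  rw [this]
  cases b <;> simp [hc]

lemma Close.exists_digitCount {n α β : ℕ} (h : Close α β) (hn : α + β ≤ 2 ^ n) :
    ∃ p ≤ n, ∃ b, digitCount p b (α + β) = α ∧ digitCount p (!b) (α + β) = β := by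
  have key : ∃ p b, digitCount p b (α + β) = α ∧ digitCount p (!b) (α + β) = β := by
    rcases le_total β α with hle | hle
    · obtain ⟨p, h1, h2⟩ := h.exists_digitCount_of_le hle
      exact ⟨p, false, h1, h2⟩
    · obtain ⟨p, h1, h2⟩ := h.symm.exists_digitCount_of_le hle
      rw [add_comm β α] at h1 h2
      exact ⟨p, true, h2, h1⟩
  obtain ⟨p, b, h1, h2⟩ := key
  rcases le_or_gt p n with hp | hp
  · exact ⟨p, hp, b, h1, h2⟩
  -- Below `2 ^ n` the digits at positions `p` and `n` are both always `0`, so `p` may be lowered to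
  -- `n`.
  · refine ⟨n, le_rfl, b, ?_⟩
    have hn' : α + β ≤ 2 ^ p := hn.trans (Nat.pow_le_pow_right two_pos hp.le)
    rw [digitCount_of_le hn'] at h1 h2
    rw [digitCount_of_le hn, digitCount_of_le hn]
    exact ⟨h1, h2⟩

/-- Two of the parts occupy opposite half cubes, up to the trace of the third. -/
lemma close_of_subset_halves {n a b c : ℕ} {A B C : Set (Fin (n + 1) → Bool)}
    (hA : IsSegment a A) (hC : IsSegment c C) (hAB : Disjoint A B)
    (hAC : Disjoint A C) (hBC : Disjoint B C) (hU : ∀ x, x ∈ A ∨ x ∈ B ∨ x ∈ C)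
    (ha : a ≤ 2 ^ n) (hb : b ≤ 2 ^ n) (habc : a + b + c = 2 ^ (n + 1)) {j : Fin (n + 1)} {d : Bool}
    (hAj : ∀ x ∈ A, x j = d) (hBj : ∀ x ∈ B, x j = !d) : Close (2 ^ n - a) (2 ^ n - b) := by
  have hpow : 2 ^ (n + 1) = 2 ^ n + 2 ^ n := by ring
  -- The half containing `A` misses `B`, so the slice of `C` there has size `2 ^ n - a`.
  have hsum := ncard_add_ncard_add_ncard (disjoint_slice (j := j) (b := d) hAB)
    (disjoint_slice hAC) (disjoint_slice hBC) (fun x => hU _)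
  rw [ncard_slice_of_subset hAj, slice_eq_empty hBj, hA.ncard_eq (by omega), Set.ncard_empty]
    at hsum
  obtain ⟨p, b', hp, h'⟩ := hC.exists_slice j d
  rw [h'.ncard_eq (digitCount_le hp b' (by omega))] at hsum
  have h1 := digitCount_true_add_false p c
  cases b'
  · rw [show 2 ^ n - a = digitCount p false c by omega,
      show 2 ^ n - b = digitCount p true c by omega]
    exact (close_digitCount p c).symm
  · rw [show 2 ^ n - a = digitCount p true c by omega,
      show 2 ^ n - b = digitCount p false c by omega]
    exact close_digitCount p c

/-- Take the third part to be an initial segment and cut along the digit supplied by closeness: what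
remains of each half is the complement of a segment. -/
lemma hasPartition_of_close {n a b c : ℕ} (ha : a ≤ 2 ^ n) (hb : b ≤ 2 ^ n) (hc : c ≤ 2 ^ n)
    (habc : a + b + c = 2 ^ (n + 1)) (h : Close (2 ^ n - a) (2 ^ n - b)) :
    HasPartition (n + 1) a b c := by
  have hpow : 2 ^ (n + 1) = 2 ^ n + 2 ^ n := by ring
  obtain ⟨p, hp, d, h1, h2⟩ := h.exists_digitCount (n := n) (by omega)
  rw [show 2 ^ n - a + (2 ^ n - b) = c by omega] at h1 h2
  have hj : n - (n - p) = p := by omega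
  have key : ∀ d' : Bool, IsSegment (2 ^ n - digitCount p d' c)
      {x : Fin (n + 1) → Bool | x ⟨n - p, by omega⟩ = d' ∧ x ∉ initialSegment (n + 1) c} := by
    intro d'
    have hs := insertNth_preimage_initialSegment (n := n) ⟨n - p, by omega⟩ d' c
    simp only [hj] at hs
    have h3 : IsSegment (digitCount p d' c) (initialSegment n (digitCount p d' c)) :=
      ⟨RelIso.refl _, by ext; simp⟩
    have h4 := (h3.compl (digitCount_le hp d' (by omega))).insert (by omega) ⟨n - p, by omega⟩ d'
    convert h4 using 1
    ext x
    rw [← hs]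
    simp only [Set.mem_ofPred_eq, Set.mem_compl_iff]
    refine and_congr_right fun hx => ?_
    rw [← hx, Fin.insertNth_self_removeNth]
  have h5 := key d
  have h6 := key (!d)
  rw [h1, Nat.sub_sub_self ha] at h5
  rw [h2, Nat.sub_sub_self hb] at h6
  refine ⟨_, _, initialSegment (n + 1) c, h5, h6, ⟨RelIso.refl _, by ext; simp⟩, ?_, ?_, ?_, ?_⟩
  · refine Set.disjoint_left.2 fun x hx hy => ?_
    have := hx.1.symm.trans hy.1
    simp at this
  · exact Set.disjoint_left.2 fun x hx hy => hx.2 hy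
  · exact Set.disjoint_left.2 fun x hx hy => hx.2 hy
  · intro x
    simp only [Set.mem_ofPred_eq]
    by_cases hx : x ∈ initialSegment (n + 1) c
    · tauto
    · cases x ⟨n - p, by omega⟩ <;> cases d <;> simp [hx]

/-- Each part lies in a half cube. Unless two of these halves are opposite, some vertex avoids all
three. -/
theorem hasPartition_succ_iff_close {n a b c : ℕ} (ha : a ≤ 2 ^ n) (hb : b ≤ 2 ^ n)
    (hc : c ≤ 2 ^ n) (habc : a + b + c = 2 ^ (n + 1)) :
    HasPartition (n + 1) a b c ↔ Close (2 ^ n - a) (2 ^ n - b) ∨ Close (2 ^ n - a) (2 ^ n - c) ∨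
      Close (2 ^ n - b) (2 ^ n - c) := by
  constructor
  · rintro ⟨A, B, C, hA, hB, hC, hAB, hAC, hBC, hU⟩
    obtain ⟨j₁, b₁, h1⟩ := hA.exists_subset_half ha
    obtain ⟨j₂, b₂, h2⟩ := hB.exists_subset_half hb
    obtain ⟨j₃, b₃, h3⟩ := hC.exists_subset_half hc
    by_cases h12 : j₁ = j₂ ∧ b₂ = !b₁
    · obtain ⟨rfl, rfl⟩ := h12
      exact Or.inl (close_of_subset_halves hA hC hAB hAC hBC hU ha hb habc h1 h2)
    by_cases h13 : j₁ = j₃ ∧ b₃ = !b₁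
    · obtain ⟨rfl, rfl⟩ := h13
      exact Or.inr (Or.inl (close_of_subset_halves hA hB hAC hAB hBC.symm
        (fun x => by have := hU x; tauto) ha hc (by omega) h1 h3))
    by_cases h23 : j₂ = j₃ ∧ b₃ = !b₂
    · obtain ⟨rfl, rfl⟩ := h23
      exact Or.inr (Or.inr (close_of_subset_halves hB hA hBC hAB.symm hAC.symm
        (fun x => by have := hU x; tauto) hb hc (by omega) h2 h3))
    exfalso
    -- This vertex violates every half-cube condition: where two coordinates coincide, the required
    -- signs agree.
    rcases hU (fun k => if k = j₁ then !b₁ else if k = j₂ then !b₂ else !b₃) with hx | hx | hx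
    · have := h1 _ hx
      simp at this
    · have := h2 _ hx
      by_cases e : j₂ = j₁
      · rw [if_pos e] at this
        exact h12 ⟨e.symm, this.symm⟩
      · simp [e] at this
    · have := h3 _ hx
      by_cases e : j₃ = j₁
      · rw [if_pos e] at this
        exact h13 ⟨e.symm, this.symm⟩
      · rw [if_neg e] at this
        by_cases e' : j₃ = j₂
        · rw [if_pos e'] at this
          exact h23 ⟨e'.symm, this.symm⟩
        · simp [e'] at this
  · rintro (h | h | h)
    · exact hasPartition_of_close ha hb hc habc h
    · exact (hasPartition_of_close ha hc hb (by omega) h).swap_right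
    · exact (hasPartition_of_close hb hc ha (by omega) h).swap_right.swap_left

/-- Fitness can be tested in any one cube. -/
theorem fit_iff_hasPartition {n a b : ℕ} (hab : a + b ≤ 2 ^ n) :
    Fit a b ↔ HasPartition n a b (2 ^ n - (a + b)) := by
  have step : ∀ k, a + b ≤ 2 ^ k → (HasPartition (k + 1) a b (2 ^ (k + 1) - (a + b)) ↔
      HasPartition k a b (2 ^ k - (a + b))) := by
    intro k hk
    have hpow : 2 ^ (k + 1) = 2 ^ k + 2 ^ k := by ring
    rw [hasPartition_succ_iff (by omega) (by omega),
      show 2 ^ (k + 1) - (a + b) - 2 ^ k = 2 ^ k - (a + b) by omega]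
  have up : ∀ k l, k ≤ l → a + b ≤ 2 ^ k → (HasPartition l a b (2 ^ l - (a + b)) ↔
      HasPartition k a b (2 ^ k - (a + b))) := by
    intro k l hkl hk
    induction l, hkl using Nat.le_induction with
    | base => rfl
    | succ l hkl ih =>
      rw [step l (hk.trans (Nat.pow_le_pow_right two_pos hkl)), ih]
  constructor
  · exact fun h => (hasPartition_iff_exists_iso hab).2 (h n hab)
  · intro h N hN
    rw [← hasPartition_iff_exists_iso hN]
    rcases le_total n N with hle | hle
    · exact (up n N hle hab).2 h
    · exact (up N n hle hN).1 h

/-! ### Counting unfit pairs through triples -/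

/-- Ordered triples of naturals with a given sum. -/
def triplesWithSum (s : ℕ) : Finset (ℕ × ℕ × ℕ) :=
  (Finset.range (s + 1) ×ˢ Finset.range (s + 1) ×ˢ Finset.range (s + 1)).filter
    fun t => t.1 + t.2.1 + t.2.2 = s

lemma mem_triplesWithSum {s : ℕ} {t : ℕ × ℕ × ℕ} :
    t ∈ triplesWithSum s ↔ t.1 + t.2.1 + t.2.2 = s := by
  simp only [triplesWithSum, Finset.mem_filter, Finset.mem_product, Finset.mem_range]
  omega

open scoped Classical in
/-- The triples with sum `2 ^ n` no two entries of which are close. -/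
noncomputable def farTriples (n : ℕ) : Finset (ℕ × ℕ × ℕ) :=
  (triplesWithSum (2 ^ n)).filter
    fun t => ¬ Close t.1 t.2.1 ∧ ¬ Close t.1 t.2.2 ∧ ¬ Close t.2.1 t.2.2

lemma mem_farTriples {n : ℕ} {t : ℕ × ℕ × ℕ} : t ∈ farTriples n ↔
    t.1 + t.2.1 + t.2.2 = 2 ^ n ∧ ¬ Close t.1 t.2.1 ∧ ¬ Close t.1 t.2.2 ∧ ¬ Close t.2.1 t.2.2 := by
  classical
  rw [farTriples, Finset.mem_filter, mem_triplesWithSum]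

open scoped Classical in
/-- The triples with sum `2 ^ n` into which `Q_n` cannot be partitioned. -/
noncomputable def unfitTriples (n : ℕ) : Finset (ℕ × ℕ × ℕ) :=
  (triplesWithSum (2 ^ n)).filter fun t => ¬ HasPartition n t.1 t.2.1 t.2.2

lemma mem_unfitTriples {n : ℕ} {t : ℕ × ℕ × ℕ} : t ∈ unfitTriples n ↔
    t.1 + t.2.1 + t.2.2 = 2 ^ n ∧ ¬ HasPartition n t.1 t.2.1 t.2.2 := by
  classical
  rw [unfitTriples, Finset.mem_filter, mem_triplesWithSum]

lemma hasPartition_zero_left {n b c : ℕ} (h : b + c = 2 ^ n) : HasPartition n 0 b c := by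
  have hb : IsSegment b (initialSegment n b) := ⟨RelIso.refl _, by ext; simp⟩
  have hc := hb.compl (by omega)
  rw [show 2 ^ n - b = c by omega] at hc
  exact ⟨_, _, _, isSegment_empty n, hb, hc, Set.empty_disjoint _, Set.empty_disjoint _,
    disjoint_compl_right, fun x => Or.inr (Classical.em _)⟩

lemma pos_of_mem_unfitTriples {n : ℕ} {t : ℕ × ℕ × ℕ} (h : t ∈ unfitTriples n) :
    0 < t.1 ∧ 0 < t.2.1 ∧ 0 < t.2.2 := by
  obtain ⟨a, b, c⟩ := t
  obtain ⟨h1, h2⟩ := mem_unfitTriples.1 h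
  dsimp only at *
  refine ⟨Nat.pos_of_ne_zero ?_, Nat.pos_of_ne_zero ?_, Nat.pos_of_ne_zero ?_⟩ <;> rintro rfl
  · exact h2 (hasPartition_zero_left (by omega))
  · exact h2 (hasPartition_zero_left (by omega)).swap_left
  · exact h2 (hasPartition_zero_left (b := a) (c := b) (by omega)).swap_left.swap_right

lemma pos_of_mem_farTriples {n : ℕ} {t : ℕ × ℕ × ℕ} (h : t ∈ farTriples n) :
    0 < t.1 ∧ 0 < t.2.1 ∧ 0 < t.2.2 := by
  obtain ⟨a, b, c⟩ := t
  obtain ⟨-, h1, h2, h3⟩ := mem_farTriples.1 h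
  dsimp only at *
  refine ⟨Nat.pos_of_ne_zero ?_, Nat.pos_of_ne_zero ?_, Nat.pos_of_ne_zero ?_⟩ <;> rintro rfl
  · exact h1 (close_zero_left _)
  · exact h1 (close_zero_left _).symm
  · exact h2 (close_zero_left _).symm

lemma hasPartition_comm_left {n a b c : ℕ} : HasPartition n a b c ↔ HasPartition n b a c :=
  ⟨HasPartition.swap_left, HasPartition.swap_left⟩

lemma hasPartition_comm_right {n a b c : ℕ} : HasPartition n a b c ↔ HasPartition n a c b :=
  ⟨HasPartition.swap_right, HasPartition.swap_right⟩

/-- Dimension reduction, as a bijection subtracting `2 ^ n` from the large entry. -/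
lemma card_unfitTriples_third (n : ℕ) :
    ((unfitTriples (n + 1)).filter fun t => 2 ^ n < t.2.2).card = (unfitTriples n).card := by
  have hpow : 2 ^ (n + 1) = 2 ^ n + 2 ^ n := by ring
  refine Finset.card_nbij' (fun t => (t.1, t.2.1, t.2.2 - 2 ^ n))
    (fun t => (t.1, t.2.1, t.2.2 + 2 ^ n)) ?_ ?_ ?_ ?_
  · rintro ⟨a, b, c⟩ ht
    simp only [Finset.coe_filter, Set.mem_ofPred_eq, mem_unfitTriples, Finset.mem_coe] at ht ⊢
    obtain ⟨⟨h1, h2⟩, h3⟩ := ht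
    rw [hasPartition_succ_iff h3.le h1] at h2
    exact ⟨by omega, h2⟩
  · rintro ⟨a, b, c⟩ ht
    have hpos := pos_of_mem_unfitTriples ht
    simp only [Finset.coe_filter, Set.mem_ofPred_eq, mem_unfitTriples, Finset.mem_coe] at ht hpos ⊢
    refine ⟨⟨by omega, ?_⟩, by omega⟩
    rw [hasPartition_succ_iff (by omega) (by omega), Nat.add_sub_cancel]
    exact ht.2
  · rintro ⟨a, b, c⟩ ht
    simp only [Finset.coe_filter, Set.mem_ofPred_eq] at ht
    simp only [Prod.mk.injEq, true_and]
    omega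
  · rintro ⟨a, b, c⟩ -
    simp

/-- Replacing each entry `x` by `2 ^ n - x` turns the sum `2 ^ (n + 1)` into `3 * 2 ^ n - 2 ^ (n +
1) = 2 ^ n` and the partition criterion into closeness. -/
lemma card_unfitTriples_small (n : ℕ) :
    ((unfitTriples (n + 1)).filter fun t => t.1 ≤ 2 ^ n ∧ t.2.1 ≤ 2 ^ n ∧ t.2.2 ≤ 2 ^ n).card =
      (farTriples n).card := by
  have hpow : 2 ^ (n + 1) = 2 ^ n + 2 ^ n := by ring
  refine Finset.card_nbij' (fun t => (2 ^ n - t.1, 2 ^ n - t.2.1, 2 ^ n - t.2.2))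
    (fun t => (2 ^ n - t.1, 2 ^ n - t.2.1, 2 ^ n - t.2.2)) ?_ ?_ ?_ ?_
  · rintro ⟨a, b, c⟩ ht
    simp only [Finset.coe_filter, Set.mem_ofPred_eq, mem_unfitTriples, mem_farTriples,
      Finset.mem_coe] at ht ⊢
    obtain ⟨⟨h1, h2⟩, h3, h4, h5⟩ := ht
    rw [hasPartition_succ_iff_close h3 h4 h5 h1] at h2
    exact ⟨by omega, by tauto⟩
  · rintro ⟨a, b, c⟩ ht
    simp only [Finset.coe_filter, Set.mem_ofPred_eq, mem_unfitTriples, mem_farTriples,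
      Finset.mem_coe] at ht ⊢
    refine ⟨⟨by omega, ?_⟩, by omega, by omega, by omega⟩
    rw [hasPartition_succ_iff_close (by omega) (by omega) (by omega) (by omega),
      Nat.sub_sub_self (by omega), Nat.sub_sub_self (by omega), Nat.sub_sub_self (by omega)]
    tauto
  · rintro ⟨a, b, c⟩ ht
    simp only [Finset.coe_filter, Set.mem_ofPred_eq] at ht
    simp only [Prod.mk.injEq]
    omega
  · rintro ⟨a, b, c⟩ ht
    simp only [Finset.mem_coe, mem_farTriples] at ht
    simp only [Prod.mk.injEq]
    omega

/-- Cyclic rotation preserves the size of a set of triples closed under permutations. -/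
lemma card_filter_rotate {s : Finset (ℕ × ℕ × ℕ)}
    (hs : ∀ a b c, (a, b, c) ∈ s ↔ (b, c, a) ∈ s) (p : ℕ × ℕ × ℕ → Prop) [DecidablePred p] :
    (s.filter fun t => p (t.2.1, t.2.2, t.1)).card = (s.filter p).card := by
  refine Finset.card_nbij' (fun t => (t.2.1, t.2.2, t.1)) (fun t => (t.2.2, t.1, t.2.1)) ?_ ?_ ?_ ?_
  · rintro ⟨a, b, c⟩ ht
    simp only [Finset.coe_filter, Set.mem_ofPred_eq] at ht ⊢
    exact ⟨(hs _ _ _).1 ht.1, ht.2⟩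
  · rintro ⟨a, b, c⟩ ht
    simp only [Finset.coe_filter, Set.mem_ofPred_eq] at ht ⊢
    exact ⟨(hs _ _ _).2 ht.1, ht.2⟩
  · rintro ⟨a, b, c⟩ -
    rfl
  · rintro ⟨a, b, c⟩ -
    rfl

/-- Counting by four mutually exclusive and exhaustive alternatives. -/
lemma card_eq_card_filter_four {α : Type*} {s : Finset α} (p q r t : α → Prop) [DecidablePred p]
    [DecidablePred q] [DecidablePred r] [DecidablePred t]
    (h : ∀ x ∈ s, (p x ∧ ¬ q x ∧ ¬ r x ∧ ¬ t x) ∨ (¬ p x ∧ q x ∧ ¬ r x ∧ ¬ t x) ∨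
      (¬ p x ∧ ¬ q x ∧ r x ∧ ¬ t x) ∨ (¬ p x ∧ ¬ q x ∧ ¬ r x ∧ t x)) :
    s.card = (s.filter p).card + (s.filter q).card + (s.filter r).card + (s.filter t).card := by
  simp only [Finset.card_filter]
  rw [← Finset.sum_add_distrib, ← Finset.sum_add_distrib, ← Finset.sum_add_distrib,
    Finset.card_eq_sum_ones]
  refine Finset.sum_congr rfl fun x hx => ?_
  rcases h x hx with ⟨h1, h2, h3, h4⟩ | ⟨h1, h2, h3, h4⟩ | ⟨h1, h2, h3, h4⟩ | ⟨h1, h2, h3, h4⟩ <;>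
    simp [h1, h2, h3, h4]

lemma unfitTriples_rotate (n a b c : ℕ) : (a, b, c) ∈ unfitTriples n ↔ (b, c, a) ∈ unfitTriples n := by
  simp only [mem_unfitTriples]
  rw [hasPartition_comm_left, hasPartition_comm_right]
  constructor <;> rintro ⟨h1, h2⟩ <;> exact ⟨by omega, h2⟩

lemma farTriples_rotate (n a b c : ℕ) : (a, b, c) ∈ farTriples n ↔ (b, c, a) ∈ farTriples n := by
  simp only [mem_farTriples]
  rw [close_comm (α := b) (β := a), close_comm (α := c) (β := a)]
  constructor <;> rintro ⟨h1, h2, h3, h4⟩ <;> exact ⟨by omega, by tauto⟩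

/-- At most one entry can exceed half of the sum; the three positions for it are equivalent by
rotation. -/
theorem card_unfitTriples_succ (n : ℕ) :
    (unfitTriples (n + 1)).card = (farTriples n).card + 3 * (unfitTriples n).card := by
  have hpow : 2 ^ (n + 1) = 2 ^ n + 2 ^ n := by ring
  have h := card_eq_card_filter_four (s := unfitTriples (n + 1))
    (fun t => t.1 ≤ 2 ^ n ∧ t.2.1 ≤ 2 ^ n ∧ t.2.2 ≤ 2 ^ n) (fun t => 2 ^ n < t.2.2)
    (fun t => 2 ^ n < t.1) (fun t => 2 ^ n < t.2.1) (by
      rintro ⟨a, b, c⟩ ht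
      have h1 := (mem_unfitTriples.1 ht).1
      have h2 := pos_of_mem_unfitTriples ht
      dsimp only at *
      omega)
  have r1 := card_filter_rotate (unfitTriples_rotate (n + 1)) (fun t => 2 ^ n < t.2.2)
  have r2 := card_filter_rotate (unfitTriples_rotate (n + 1)) (fun t => 2 ^ n < t.1)
  dsimp only at r1 r2
  rw [h, card_unfitTriples_small, r2, r1, card_unfitTriples_third]
  ring

/-- Pairs with `a + b ≤ 2 ^ n` extend to triples of sum `2 ^ n`. For the others, the completion to
sum `2 ^ (n + 1)` has all entries at most `2 ^ n`, and complementing gives a far triple. -/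
theorem unfitCount_eq (n : ℕ) : unfitCount n = (farTriples n).card + (unfitTriples n).card := by
  classical
  have hpow : 2 ^ (n + 1) = 2 ^ n + 2 ^ n := by ring
  have hset : {p : ℕ × ℕ | (0 < p.1 ∧ p.1 ≤ 2 ^ n) ∧ (0 < p.2 ∧ p.2 ≤ 2 ^ n) ∧ Unfit p.1 p.2} =
      ((farTriples n).image (fun t => (2 ^ n - t.1, 2 ^ n - t.2.1)) ∪
        (unfitTriples n).image (fun t => (t.1, t.2.1)) : Finset (ℕ × ℕ)) := by
    ext ⟨a, b⟩
    simp only [Set.mem_ofPred_eq, Finset.coe_union, Finset.coe_image, Set.mem_union, Set.mem_image,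
      Finset.mem_coe, Prod.mk.injEq]
    constructor
    · rintro ⟨⟨ha, ha'⟩, ⟨hb, hb'⟩, hu⟩
      rcases le_or_gt (a + b) (2 ^ n) with hab | hab
      · right
        rw [Unfit, fit_iff_hasPartition hab] at hu
        exact ⟨(a, b, 2 ^ n - (a + b)), mem_unfitTriples.2 ⟨by dsimp only; omega, hu⟩, rfl, rfl⟩
      · left
        rw [Unfit, fit_iff_hasPartition (n := n + 1) (by omega),
          hasPartition_succ_iff_close (by omega) (by omega) (by omega) (by omega)] at hu
        refine ⟨(2 ^ n - a, 2 ^ n - b, 2 ^ n - (2 ^ (n + 1) - (a + b))),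
          mem_farTriples.2 ⟨by dsimp only; omega, by tauto⟩, ?_, ?_⟩
        · exact Nat.sub_sub_self ha'
        · exact Nat.sub_sub_self hb'
    · rintro (⟨⟨x, y, z⟩, ht, rfl, rfl⟩ | ⟨⟨x, y, z⟩, ht, rfl, rfl⟩)
      · have hpos := pos_of_mem_farTriples ht
        obtain ⟨h1, h2⟩ := mem_farTriples.1 ht
        dsimp only at *
        refine ⟨by omega, by omega, ?_⟩
        rw [Unfit, fit_iff_hasPartition (n := n + 1) (by omega),
          hasPartition_succ_iff_close (by omega) (by omega) (by omega) (by omega),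
          Nat.sub_sub_self (by omega), Nat.sub_sub_self (by omega),
          show 2 ^ n - (2 ^ (n + 1) - (2 ^ n - x + (2 ^ n - y))) = z by omega]
        tauto
      · have hpos := pos_of_mem_unfitTriples ht
        obtain ⟨h1, h2⟩ := mem_unfitTriples.1 ht
        dsimp only at *
        refine ⟨by omega, by omega, ?_⟩
        rw [Unfit, fit_iff_hasPartition (n := n) (by omega),
          show 2 ^ n - (x + y) = z by omega]
        exact h2
  rw [unfitCount, hset, Set.ncard_coe_finset, Finset.card_union_of_disjoint,
    Finset.card_image_of_injOn, Finset.card_image_of_injOn]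
  · rintro ⟨a, b, c⟩ ht ⟨a', b', c'⟩ ht' h
    have h1 := (mem_unfitTriples.1 ht).1
    have h2 := (mem_unfitTriples.1 ht').1
    simp only [Prod.mk.injEq] at *
    omega
  · rintro ⟨a, b, c⟩ ht ⟨a', b', c'⟩ ht' h
    have h1 := (mem_farTriples.1 ht).1
    have h2 := (mem_farTriples.1 ht').1
    simp only [Prod.mk.injEq] at *
    omega
  · rw [Finset.disjoint_left]
    rintro ⟨u, v⟩ h1 h2
    obtain ⟨⟨a, b, c⟩, ht, h3⟩ := Finset.mem_image.1 h1
    obtain ⟨⟨a', b', c'⟩, ht', h4⟩ := Finset.mem_image.1 h2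
    have := pos_of_mem_farTriples ht
    have h1 := (mem_farTriples.1 ht).1
    have h2 := (mem_unfitTriples.1 ht').1
    simp only [Prod.mk.injEq] at *
    omega

/-! ### Triples by parity -/

lemma close_two_mul {x y : ℕ} : Close (2 * x) (2 * y) ↔ Close x y := by
  constructor
  · rintro ⟨p, h1, h2, h3⟩
    cases p with
    | zero => exact ⟨0, by simp, by omega, by omega⟩
    | succ p =>
      rw [pow_succ', Nat.mul_dvd_mul_iff_left two_pos, Nat.mul_dvd_mul_iff_left two_pos] at *
      exact ⟨p, h1, by omega, by omega⟩
  · rintro ⟨p, h1, h2, h3⟩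
    refine ⟨p + 1, ?_, ?_, ?_⟩
    · rwa [pow_succ', Nat.mul_dvd_mul_iff_left two_pos, Nat.mul_dvd_mul_iff_left two_pos]
    · rw [pow_succ']; omega
    · rw [pow_succ']; omega

/-- Only `p = 0` is available, and two odd numbers at distance at most `1` are equal. -/
lemma close_odd_odd {x y : ℕ} : Close (2 * x + 1) (2 * y + 1) ↔ x = y := by
  constructor
  · rintro ⟨p, h1, h2, h3⟩
    cases p with
    | zero => rw [pow_zero] at *; omega
    | succ p =>
      rcases h1 with h1 | h1 <;>
      · have := (Dvd.intro _ (pow_succ' 2 p).symm).trans h1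
        omega
  · rintro rfl
    exact ⟨0, by simp, by omega, by omega⟩

/-- The largest power of two dividing `g`. -/
def lowBit (g : ℕ) : ℕ := 2 ^ padicValNat 2 g

lemma lowBit_two_mul {g : ℕ} (hg : g ≠ 0) : lowBit (2 * g) = 2 * lowBit g := by
  rw [lowBit, padicValNat.mul two_ne_zero hg, padicValNat_self, add_comm, pow_succ']
  rfl

lemma lowBit_odd (g : ℕ) : lowBit (2 * g + 1) = 1 := by
  rw [lowBit, padicValNat.eq_zero_of_not_dvd (by omega), pow_zero]

/-- The power must divide the even number, and the largest such power is the least restrictive: the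
condition is `|2x + 1 - 2g| ≤ 2 * lowBit g`. -/
lemma close_odd_even {x g : ℕ} (hg : g ≠ 0) :
    Close (2 * x + 1) (2 * g) ↔ g ≤ x + lowBit g ∧ x < g + lowBit g := by
  have hpos : 0 < lowBit g := by unfold lowBit; positivity
  constructor
  · rintro ⟨p, h1, h2, h3⟩
    cases p with
    | zero => rw [pow_zero] at *; omega
    | succ p =>
      have h4 : ¬ 2 ^ (p + 1) ∣ 2 * x + 1 := fun h => by
        have := (Dvd.intro _ (pow_succ' 2 p).symm).trans h
        omega
      have h5 := h1.resolve_left h4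
      rw [pow_succ', Nat.mul_dvd_mul_iff_left two_pos, padicValNat_dvd_iff_le hg] at h5
      have h6 : 2 ^ p ≤ lowBit g := Nat.pow_le_pow_right two_pos h5
      rw [pow_succ'] at h2 h3
      omega
  · rintro ⟨h1, h2⟩
    refine ⟨padicValNat 2 g + 1, Or.inr ?_, ?_, ?_⟩
    · rw [pow_succ', Nat.mul_dvd_mul_iff_left two_pos]
      exact pow_padicValNat_dvd
    · rw [pow_succ', ← lowBit]; omega
    · rw [pow_succ', ← lowBit]; omega

/-! ### Far triples with two odd entries -/

/-- The far triples whose first two entries are odd. -/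
noncomputable def oddTriples (n : ℕ) : Finset (ℕ × ℕ × ℕ) :=
  (farTriples (n + 1)).filter fun t => t.1 % 2 = 1 ∧ t.2.1 % 2 = 1

/-- The sum is even, so either all entries are even and can be halved, or exactly two are odd, in
one of three positions. -/
theorem card_farTriples_succ (n : ℕ) :
    (farTriples (n + 1)).card = (farTriples n).card + 3 * (oddTriples n).card := by
  have hpow : 2 ^ (n + 1) = 2 * 2 ^ n := by ring
  have h := card_eq_card_filter_four (s := farTriples (n + 1))
    (fun t => t.1 % 2 = 0 ∧ t.2.1 % 2 = 0) (fun t => t.1 % 2 = 1 ∧ t.2.1 % 2 = 1)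
    (fun t => t.2.1 % 2 = 1 ∧ t.2.2 % 2 = 1) (fun t => t.2.2 % 2 = 1 ∧ t.1 % 2 = 1) (by
      rintro ⟨a, b, c⟩ ht
      have h1 := (mem_farTriples.1 ht).1
      dsimp only at *
      omega)
  have r1 := card_filter_rotate (farTriples_rotate (n + 1)) (fun t => t.1 % 2 = 1 ∧ t.2.1 % 2 = 1)
  have r2 := card_filter_rotate (farTriples_rotate (n + 1))
    (fun t => t.2.1 % 2 = 1 ∧ t.2.2 % 2 = 1)
  have h0 : ((farTriples (n + 1)).filter fun t => t.1 % 2 = 0 ∧ t.2.1 % 2 = 0).card =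
      (farTriples n).card := by
    refine Finset.card_nbij' (fun t => (t.1 / 2, t.2.1 / 2, t.2.2 / 2))
      (fun t => (2 * t.1, 2 * t.2.1, 2 * t.2.2)) ?_ ?_ ?_ ?_
    · rintro ⟨a, b, c⟩ ht
      simp only [Finset.coe_filter, Set.mem_ofPred_eq, mem_farTriples, Finset.mem_coe] at ht ⊢
      refine ⟨by omega, ?_⟩
      rw [← close_two_mul, ← close_two_mul (x := a / 2) (y := c / 2),
        ← close_two_mul (x := b / 2) (y := c / 2), show 2 * (a / 2) = a by omega,
        show 2 * (b / 2) = b by omega, show 2 * (c / 2) = c by omega]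
      exact ht.1.2
    · rintro ⟨a, b, c⟩ ht
      simp only [Finset.coe_filter, Set.mem_ofPred_eq, mem_farTriples, Finset.mem_coe,
        close_two_mul] at ht ⊢
      exact ⟨⟨by omega, ht.2⟩, by omega, by omega⟩
    · rintro ⟨a, b, c⟩ ht
      simp only [Finset.coe_filter, Set.mem_ofPred_eq, mem_farTriples] at ht
      simp only [Prod.mk.injEq]
      omega
    · rintro ⟨a, b, c⟩ -
      simp
  dsimp only at r1 r2
  rw [h, h0, r2, r1, ← oddTriples]
  ring

/-- The `x` with `(2 * x + 1, 2 * y + 1, 2 * g)` a far triple with sum `2 * P`. -/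
def farFiber (P g : ℕ) : Finset ℕ :=
  -- With `y = P - g - x - 1`, the three conditions say that no pair is close: `x ≠ y`, then `2x +
  -- 1` against `2g`, then `2y + 1` against `2g`.
  (Finset.range (P - g)).filter fun x => 2 * x + 1 + g ≠ P ∧
    ¬ (g ≤ x + lowBit g ∧ x < g + lowBit g) ∧
    ¬ (2 * g + x + 1 ≤ P + lowBit g ∧ P ≤ 2 * g + x + lowBit g)

lemma card_oddTriples (n : ℕ) :
    (oddTriples n).card = ∑ g ∈ Finset.Ico 1 (2 ^ n), (farFiber (2 ^ n) g).card := by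
  have hpow : 2 ^ (n + 1) = 2 * 2 ^ n := by ring
  rw [← Finset.card_sigma]
  symm
  have key : ∀ x y g : ℕ, g ≠ 0 → x + y + g + 1 = 2 ^ n → ((2 * x + 1, 2 * y + 1, 2 * g) ∈
      farTriples (n + 1) ↔ x ∈ farFiber (2 ^ n) g) := by
    intro x y g hg h
    rw [mem_farTriples, farFiber, Finset.mem_filter, Finset.mem_range]
    dsimp only
    rw [close_odd_odd, close_odd_even hg, close_odd_even hg]
    constructor
    · rintro ⟨h1, h2, h3, h4⟩
      refine ⟨by omega, by omega, by omega, by omega⟩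
    · rintro ⟨h1, h2, h3, h4⟩
      refine ⟨by omega, by omega, by omega, by omega⟩
  refine Finset.card_nbij' (fun s => (2 * s.2 + 1, 2 * (2 ^ n - (s.2 + s.1 + 1)) + 1, 2 * s.1))
    (fun t => ⟨t.2.2 / 2, t.1 / 2⟩) ?_ ?_ ?_ ?_
  · rintro ⟨g, x⟩ hs
    simp only [Finset.coe_sigma, Set.mem_sigma_iff, Finset.mem_coe, Finset.mem_Ico] at hs
    have hx := Finset.mem_range.1 (Finset.mem_filter.1 hs.2).1
    simp only [oddTriples, Finset.coe_filter, Set.mem_ofPred_eq]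
    refine ⟨(key _ _ _ (by omega) (by omega)).2 hs.2, by omega, by omega⟩
  · rintro ⟨a, b, c⟩ ht
    simp only [oddTriples, Finset.coe_filter, Set.mem_ofPred_eq] at ht
    obtain ⟨ht, h1, h2⟩ := ht
    have h3 := pos_of_mem_farTriples ht
    have h4 := (mem_farTriples.1 ht).1
    dsimp only at h3 h4
    simp only [Finset.coe_sigma, Set.mem_sigma_iff, Finset.mem_coe, Finset.mem_Ico]
    refine ⟨by omega, (key _ (b / 2) _ (by omega) (by omega)).1 ?_⟩
    rwa [show 2 * (a / 2) + 1 = a by omega, show 2 * (b / 2) + 1 = b by omega,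
      show 2 * (c / 2) = c by omega]
  · rintro ⟨g, x⟩ -
    have h1 : 2 * g / 2 = g := by omega
    have h2 : (2 * x + 1) / 2 = x := by omega
    simp only [h1, h2]
  · rintro ⟨a, b, c⟩ ht
    simp only [oddTriples, Finset.coe_filter, Set.mem_ofPred_eq] at ht
    obtain ⟨ht, h1, h2⟩ := ht
    have h3 := pos_of_mem_farTriples ht
    have h4 := (mem_farTriples.1 ht).1
    simp only [Prod.mk.injEq] at *
    omega

/-- Expresses `g` and `2 ^ n` in units of `lowBit g`, so that interval endpoints differ by multiples
of it. -/
lemma exists_eq_lowBit_mul {n g : ℕ} (hg : g ≠ 0) (hlt : g < 2 ^ n) :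
    ∃ m K, g = lowBit g * (2 * m + 1) ∧ 2 ^ n = lowBit g * (2 * K) ∧ 0 < lowBit g ∧
      ((lowBit g = 1 ∧ g % 2 = 1) ∨ g % 2 = 0) := by
  obtain ⟨k, m, ⟨m, rfl⟩, rfl⟩ := Nat.exists_eq_two_pow_mul_odd hg
  have hL : lowBit (2 ^ k * (2 * m + 1)) = 2 ^ k := by
    rw [lowBit, padicValNat.mul (by positivity) (by omega), padicValNat.prime_pow,
      padicValNat.eq_zero_of_not_dvd (by omega), add_zero]
  have hk : k < n := by
    rw [← Nat.pow_lt_pow_iff_right one_lt_two]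
    refine lt_of_le_of_lt (Nat.le_mul_of_pos_right _ (by omega)) hlt
  rw [hL]
  refine ⟨m, 2 ^ (n - k - 1), rfl, ?_, by positivity, ?_⟩
  · rw [← pow_succ', ← pow_add]
    congr 1
    omega
  · cases k with
    | zero => left; simp
    | succ k =>
      right
      rw [pow_succ', mul_assoc, Nat.mul_mod_right]

lemma card_filter_range_of_forall {N : ℕ} {p : ℕ → Prop} [DecidablePred p] {s : Finset ℕ}
    (h : ∀ x, ¬ (x < N ∧ p x) ∧ x < N ↔ x ∈ s) :
    ((Finset.range N).filter p).card + s.card = N := by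
  have hs : s = (Finset.range N).filter fun x => ¬ p x := by
    ext x
    rw [← h, Finset.mem_filter, Finset.mem_range]
    tauto
  rw [hs, Finset.card_filter_add_card_filter_not, Finset.card_range]

/-- Generic case `g = 2A + L`, `P = 4A + 4L + 2B`: the two closeness conditions exclude disjoint
intervals of length `2L`, and `x = y` excludes one further point precisely when `g` is odd. -/
lemma card_filter_range_far {A B L : ℕ} (hL : 0 < L)
    (hodd : (L = 1 ∧ (2 * A + L) % 2 = 1) ∨ (2 * A + L) % 2 = 0)
    (h : A + L ≤ B ∨ B + 2 * L ≤ A) :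
    ((Finset.range (4 * A + 4 * L + 2 * B - (2 * A + L))).filter fun x =>
      2 * x + 1 + (2 * A + L) ≠ 4 * A + 4 * L + 2 * B ∧
      ¬ (2 * A + L ≤ x + L ∧ x < 2 * A + L + L) ∧
      ¬ (2 * (2 * A + L) + x + 1 ≤ 4 * A + 4 * L + 2 * B + L ∧
        4 * A + 4 * L + 2 * B ≤ 2 * (2 * A + L) + x + L)).card + 4 * L + (2 * A + L) % 2 =
      4 * A + 4 * L + 2 * B - (2 * A + L) + 0 := by
  have hdisj : Disjoint (Finset.Ico (2 * A) (2 * A + 2 * L))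
      (Finset.Ico (2 * B + L) (2 * B + 3 * L)) := by
    rw [Finset.disjoint_left]
    intro x
    rw [Finset.mem_Ico, Finset.mem_Ico]
    omega
  have hcard := Finset.card_union_of_disjoint hdisj
  rw [Nat.card_Ico, Nat.card_Ico] at hcard
  rcases hodd with ⟨rfl, hodd⟩ | hodd
  · have hnot : A + B + 1 ∉ Finset.Ico (2 * A) (2 * A + 2 * 1) ∪
        Finset.Ico (2 * B + 1) (2 * B + 3 * 1) := by
      rw [Finset.mem_union, Finset.mem_Ico, Finset.mem_Ico]
      omega
    have := card_filter_range_of_forall (N := 4 * A + 4 * 1 + 2 * B - (2 * A + 1))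
      (p := fun x => 2 * x + 1 + (2 * A + 1) ≠ 4 * A + 4 * 1 + 2 * B ∧
        ¬ (2 * A + 1 ≤ x + 1 ∧ x < 2 * A + 1 + 1) ∧
        ¬ (2 * (2 * A + 1) + x + 1 ≤ 4 * A + 4 * 1 + 2 * B + 1 ∧
          4 * A + 4 * 1 + 2 * B ≤ 2 * (2 * A + 1) + x + 1))
      (s := insert (A + B + 1) (Finset.Ico (2 * A) (2 * A + 2 * 1) ∪
        Finset.Ico (2 * B + 1) (2 * B + 3 * 1))) (by
          intro x
          rw [Finset.mem_insert, Finset.mem_union, Finset.mem_Ico, Finset.mem_Ico]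
          omega)
    rw [Finset.card_insert_of_notMem hnot, hcard] at this
    omega
  · have := card_filter_range_of_forall (N := 4 * A + 4 * L + 2 * B - (2 * A + L))
      (p := fun x => 2 * x + 1 + (2 * A + L) ≠ 4 * A + 4 * L + 2 * B ∧
        ¬ (2 * A + L ≤ x + L ∧ x < 2 * A + L + L) ∧
        ¬ (2 * (2 * A + L) + x + 1 ≤ 4 * A + 4 * L + 2 * B + L ∧
          4 * A + 4 * L + 2 * B ≤ 2 * (2 * A + L) + x + L))
      (s := Finset.Ico (2 * A) (2 * A + 2 * L) ∪ Finset.Ico (2 * B + L) (2 * B + 3 * L)) (by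
          intro x
          rw [Finset.mem_union, Finset.mem_Ico, Finset.mem_Ico]
          omega)
    rw [hcard] at this
    omega

/-- The two excluded intervals, of length `2L` with `L = lowBit g`, are mirror images under `x ↔ y`,
and their offset is an odd multiple of `L`. They meet only at offset `±L`, when `g` is nearly a
third of `2 ^ n`; then the overlap has length `L` and, for odd `g`, contains the point `x = y`. The
last term corrects this double counting. -/
lemma card_farFiber_of_lt {n g : ℕ} (hg : g ≠ 0) (hlt : 2 * g < 2 ^ n) :
    (farFiber (2 ^ n) g).card + 4 * lowBit g + g % 2 = 2 ^ n - g +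
      if 3 * g = 2 ^ n + lowBit g ∨ 3 * g + lowBit g = 2 ^ n then lowBit g + g % 2 else 0 := by
  obtain ⟨m, K, h1, h2, hL, hodd⟩ := exists_eq_lowBit_mul (n := n) hg (by omega)
  unfold farFiber
  rw [h2] at hlt ⊢
  generalize lowBit g = L at *
  have hmK : 2 * m + 1 < K := by
    rw [h1] at hlt
    have : L * (2 * (2 * m + 1)) < L * (2 * K) := by linarith
    have := Nat.lt_of_mul_lt_mul_left this
    omega
  obtain ⟨d, rfl⟩ : ∃ d, K = 2 * m + 2 + d := Nat.exists_eq_add_of_le hmK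
  have e1 : L * (2 * m + 1) = 2 * (L * m) + L := by ring
  have e2 : L * (2 * (2 * m + 2 + d)) = 4 * (L * m) + 4 * L + 2 * (L * d) := by ring
  rw [e1] at h1
  rw [e2] at h2 hlt ⊢
  -- The offset of the intervals is `(2(m - d) - 1)L`: the first two cases give `-L` and `L`, the
  -- other two disjoint intervals.
  have hgap : d = m ∨ d + 1 = m ∨ L * d ≥ L * m + L ∨ L * d + 2 * L ≤ L * m := by
    rcases lt_trichotomy d m with h | h | h
    · obtain ⟨e, rfl⟩ := Nat.exists_eq_add_of_lt h
      rcases Nat.eq_zero_or_pos e with rfl | he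
      · omega
      · right; right; right
        nlinarith
    · omega
    · right; right; left
      nlinarith
  generalize hLm : L * m = A at *
  generalize hLd : L * d = B at *
  rcases hgap with h | h | h | h
  · obtain rfl : B = A := by rw [← hLm, ← hLd, h]
    rw [if_pos (Or.inr (by omega))]
    have := card_filter_range_of_forall (N := 4 * B + 4 * L + 2 * B - g)
      (p := fun x => 2 * x + 1 + g ≠ 4 * B + 4 * L + 2 * B ∧ ¬ (g ≤ x + L ∧ x < g + L) ∧
        ¬ (2 * g + x + 1 ≤ 4 * B + 4 * L + 2 * B + L ∧ 4 * B + 4 * L + 2 * B ≤ 2 * g + x + L))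
      (s := Finset.Ico (2 * B) (2 * B + 3 * L)) (by intro x; rw [Finset.mem_Ico]; omega)
    rw [Nat.card_Ico] at this
    omega
  · obtain rfl : A = B + L := by rw [← hLm, ← hLd, ← h]; ring
    rw [if_pos (Or.inl (by omega))]
    have := card_filter_range_of_forall (N := 4 * (B + L) + 4 * L + 2 * B - g)
      (p := fun x => 2 * x + 1 + g ≠ 4 * (B + L) + 4 * L + 2 * B ∧ ¬ (g ≤ x + L ∧ x < g + L) ∧
        ¬ (2 * g + x + 1 ≤ 4 * (B + L) + 4 * L + 2 * B + L ∧
          4 * (B + L) + 4 * L + 2 * B ≤ 2 * g + x + L))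
      (s := Finset.Ico (2 * B + L) (2 * B + 4 * L)) (by intro x; rw [Finset.mem_Ico]; omega)
    rw [Nat.card_Ico] at this
    omega
  · rw [if_neg (by omega), h1]
    exact card_filter_range_far (by omega) (by omega) (Or.inl (by omega))
  · rw [if_neg (by omega), h1]
    exact card_filter_range_far (by omega) (by omega) (Or.inr (by omega))

/-- Here `lowBit g = g`, and every candidate falls within closeness range of `2g`. -/
lemma card_farFiber_of_eq {n g : ℕ} (hg : g ≠ 0) (heq : 2 * g = 2 ^ n) :
    (farFiber (2 ^ n) g).card = 0 := by
  have hL : lowBit g = g := by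
    cases n with
    | zero => omega
    | succ n =>
      obtain rfl : g = 2 ^ n := by rw [pow_succ'] at heq; omega
      rw [lowBit, padicValNat.prime_pow]
  rw [Finset.card_eq_zero, farFiber, Finset.filter_eq_empty_iff, ← heq, hL]
  intro x hx
  rw [Finset.mem_range] at hx
  omega

/-- Both odd entries are too small to be close to `2g`, so only `x = y` is excluded, which occurs
for odd `g`. -/
lemma card_farFiber_of_gt {n g : ℕ} (hlt : 2 ^ n < 2 * g) (hg : g < 2 ^ n) :
    (farFiber (2 ^ n) g).card + g % 2 = 2 ^ n - g := by
  obtain ⟨m, K, h1, h2, hL, hodd⟩ := exists_eq_lowBit_mul (n := n) (by omega) hg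
  unfold farFiber
  rw [h2] at hlt ⊢
  generalize lowBit g = L at *
  have hmK : K < 2 * m + 1 := by
    rw [h1] at hlt
    have : L * (2 * K) < L * (2 * (2 * m + 1)) := by linarith
    have := Nat.lt_of_mul_lt_mul_left this
    omega
  obtain ⟨d, hd⟩ : ∃ d, 2 * m = K + d := Nat.exists_eq_add_of_le (by omega)
  have e1 : L * (2 * m + 1) = L * K + L * d + L := by rw [hd]; ring
  have e2 : L * (2 * K) = 2 * (L * K) := by ring
  rw [e1] at h1
  rw [e2] at h2 hlt ⊢
  generalize L * K = A at *
  generalize L * d = B at *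
  have hP : 2 * A - g = A - B - L := by omega
  rcases hodd with ⟨hL1, hodd⟩ | hodd
  · have := card_filter_range_of_forall (N := 2 * A - g)
      (p := fun x => 2 * x + 1 + g ≠ 2 * A ∧ ¬ (g ≤ x + L ∧ x < g + L) ∧
        ¬ (2 * g + x + 1 ≤ 2 * A + L ∧ 2 * A ≤ 2 * g + x + L))
      (s := {(2 * A - g) / 2}) (by intro x; rw [Finset.mem_singleton]; omega)
    rw [Finset.card_singleton] at this
    omega
  · have := card_filter_range_of_forall (N := 2 * A - g)
      (p := fun x => 2 * x + 1 + g ≠ 2 * A ∧ ¬ (g ≤ x + L ∧ x < g + L) ∧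
        ¬ (2 * g + x + 1 ≤ 2 * A + L ∧ 2 * A ≤ 2 * g + x + L))
      (s := ∅) (by intro x; simp only [Finset.notMem_empty, iff_false]; omega)
    rw [Finset.card_empty] at this
    omega

/-! ### Summing the fibre sizes -/

lemma sum_Ico_one_two_mul (f : ℕ → ℕ) {m : ℕ} (hm : 1 ≤ m) :
    ∑ g ∈ Finset.Ico 1 (2 * m), f g =
      ∑ g ∈ Finset.Ico 1 m, f (2 * g) + ∑ g ∈ Finset.range m, f (2 * g + 1) := by
  induction m, hm using Nat.le_induction with
  | base => simp
  | succ m hm ih =>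
    rw [show 2 * (m + 1) = 2 * m + 1 + 1 by ring, Finset.sum_Ico_succ_top (by omega),
      Finset.sum_Ico_succ_top (by omega), ih, Finset.sum_Ico_succ_top hm, Finset.sum_range_succ]
    ring

lemma sum_Ico_two_pow_succ (f : ℕ → ℕ) (n : ℕ) :
    ∑ g ∈ Finset.Ico 1 (2 ^ (n + 1)), f g =
      ∑ g ∈ Finset.Ico 1 (2 ^ n), f (2 * g) + ∑ g ∈ Finset.range (2 ^ n), f (2 * g + 1) := by
  rw [pow_succ', sum_Ico_one_two_mul f Nat.one_le_two_pow]

lemma sum_lowBit (n : ℕ) : 2 * ∑ g ∈ Finset.Ico 1 (2 ^ n), lowBit g = n * 2 ^ n := by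
  induction n with
  | zero => simp
  | succ n ih =>
    rw [sum_Ico_two_pow_succ, Finset.sum_congr rfl (fun g hg => lowBit_two_mul
      (by rw [Finset.mem_Ico] at hg; omega)), ← Finset.mul_sum, ih]
    simp only [lowBit_odd, Finset.sum_const, Finset.card_range, smul_eq_mul]
    ring

lemma sum_third (n : ℕ) : (∑ g ∈ Finset.range (2 ^ n),
    if 3 * (2 * g + 1) = 2 ^ (n + 2) + 1 ∨ 3 * (2 * g + 1) + 1 = 2 ^ (n + 2) then 1 else 0) = 1 := by
  have hpow : 2 ^ (n + 2) = 4 * 2 ^ n := by ring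
  have hmod : 2 ^ n % 3 = 1 ∨ 2 ^ n % 3 = 2 := by
    induction n with
    | zero => simp
    | succ n ih => have := ih (by ring); rw [pow_succ]; omega
  rw [← Finset.card_filter, Finset.card_eq_one]
  -- Solving `3(2g + 1) = 4 * 2 ^ n ± 1` gives `g = (2 * 2 ^ n - 1) / 3` or `(2 * 2 ^ n - 2) / 3`,
  -- according to `2 ^ n` modulo `3`; the floor covers both.
  refine ⟨(2 * 2 ^ n - 1) / 3, ?_⟩
  ext g
  rw [Finset.mem_filter, Finset.mem_range, Finset.mem_singleton, hpow]
  omega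

/-- The contribution of `g` to the sum over the multiples closest to a third of `P`. -/
def nearThird (P g : ℕ) : ℕ :=
  if 3 * g = P + lowBit g ∨ 3 * g + lowBit g = P then lowBit g else 0

lemma nearThird_two_mul (P : ℕ) {g : ℕ} (hg : g ≠ 0) :
    nearThird (2 * P) (2 * g) = 2 * nearThird P g := by
  rw [nearThird, nearThird, lowBit_two_mul hg, mul_ite, mul_zero]
  congr 1
  rw [eq_iff_iff]
  omega

/-- Even terms double the previous sum and exactly one odd term contributes `1`. -/
lemma sum_nearThird (n : ℕ) :
    ∑ g ∈ Finset.Ico 1 (2 ^ n), nearThird (2 ^ (n + 1)) g + 1 = 2 ^ n := by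
  induction n with
  | zero => simp
  | succ n ih =>
    rw [sum_Ico_two_pow_succ, pow_succ' 2 (n + 1), Finset.sum_congr rfl (fun g hg =>
      nearThird_two_mul _ (by rw [Finset.mem_Ico] at hg; omega)), ← Finset.mul_sum]
    have h : ∑ g ∈ Finset.range (2 ^ n), nearThird (2 * 2 ^ (n + 1)) (2 * g + 1) = 1 := by
      simpa only [nearThird, lowBit_odd, ← pow_succ'] using sum_third n
    rw [pow_succ' 2 n] at *
    omega

lemma sum_nearThird_add (n : ℕ) :
    ∑ g ∈ Finset.Ico 1 (2 ^ (n + 1)), (if 3 * g = 2 ^ (n + 2) + lowBit g ∨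
      3 * g + lowBit g = 2 ^ (n + 2) then lowBit g + g % 2 else 0) = 2 ^ (n + 1) := by
  have h1 := sum_nearThird (n + 1)
  have h2 := sum_third n
  have h3 : ∑ g ∈ Finset.Ico 1 (2 ^ (n + 1)), (if 3 * g = 2 ^ (n + 2) + lowBit g ∨
      3 * g + lowBit g = 2 ^ (n + 2) then g % 2 else 0) = 1 := by
    rw [sum_Ico_two_pow_succ]
    simp only [Nat.mul_mod_right, ite_self, Finset.sum_const_zero, zero_add]
    refine (Finset.sum_congr rfl fun g _ => ?_).trans h2
    rw [lowBit_odd, show (2 * g + 1) % 2 = 1 by omega]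
  refine Eq.trans ?_ ((congrArg _ h3).trans h1)
  rw [← Finset.sum_add_distrib]
  refine Finset.sum_congr rfl fun g _ => ?_
  rw [nearThird]
  split_ifs <;> rfl

lemma sum_mod_two (n : ℕ) : ∑ g ∈ Finset.Ico 1 (2 ^ (n + 1)), g % 2 = 2 ^ n := by
  rw [sum_Ico_two_pow_succ]
  simp [Nat.add_mod]

lemma sum_Ico_sub (P : ℕ) : 2 * ∑ g ∈ Finset.Ico 1 P, (P - g) = P * (P - 1) := by
  have h : ∑ g ∈ Finset.Ico 1 P, (P - g) = ∑ i ∈ Finset.range P, i := by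
    rw [Finset.range_eq_Ico]
    rcases Nat.eq_zero_or_pos P with rfl | hP
    · simp
    · rw [Finset.sum_eq_sum_Ico_succ_bot hP, zero_add, zero_add]
      refine Finset.sum_nbij' (fun g => P - g) (fun g => P - g) ?_ ?_ ?_ ?_ ?_ <;>
        intro g hg <;> simp only [Finset.mem_Ico] at * <;> omega
  rw [h, mul_comm, Finset.sum_range_id_mul_two]

/-- With `P = 2 ^ N`, `N ≥ 2`, the sum of `P - g` is `P(P - 1)/2`. The intervals remove `N P - P`,
the odd `g` remove `P/2`, and `g = P/2` removes `P/2`; the overlaps near `P/3` return `P/2`. The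
total is `P ^ 2 / 2 - N P`. -/
theorem card_oddTriples_succ (n : ℕ) :
    (oddTriples (n + 1)).card + 2 ^ (n + 1) * (n + 1) = 2 ^ (n + 1) * 2 ^ n := by
  rw [card_oddTriples]
  cases n with
  | zero =>
    have := card_farFiber_of_eq (n := 1) (g := 1) one_ne_zero (by norm_num)
    simp at this ⊢
    exact this
  | succ n =>
    have hpow : 2 ^ (n + 2) = 2 * 2 ^ (n + 1) := by ring
    have hpow' : 2 ^ (n + 1) = 2 * 2 ^ n := by ring
    have hone : 1 ≤ 2 ^ n := Nat.one_le_two_pow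
    have split : ∀ f : ℕ → ℕ, ∑ g ∈ Finset.Ico 1 (2 ^ (n + 2)), f g =
        ∑ g ∈ Finset.Ico 1 (2 ^ (n + 1)), f g + f (2 ^ (n + 1)) +
          ∑ g ∈ Finset.Ico (2 ^ (n + 1) + 1) (2 ^ (n + 2)), f g := by
      intro f
      rw [← Finset.sum_Ico_succ_top (by omega), Finset.sum_Ico_consecutive _ (by omega) (by omega)]
    have hlow : ∑ g ∈ Finset.Ico 1 (2 ^ (n + 1)), (farFiber (2 ^ (n + 2)) g).card +
        4 * ∑ g ∈ Finset.Ico 1 (2 ^ (n + 1)), lowBit g + ∑ g ∈ Finset.Ico 1 (2 ^ (n + 1)), g % 2 =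
        ∑ g ∈ Finset.Ico 1 (2 ^ (n + 1)), (2 ^ (n + 2) - g) + 2 ^ (n + 1) := by
      refine Eq.trans ?_ (congrArg _ (sum_nearThird_add n))
      rw [Finset.mul_sum, ← Finset.sum_add_distrib,
        ← Finset.sum_add_distrib, ← Finset.sum_add_distrib]
      refine Finset.sum_congr rfl fun g hg => ?_
      rw [Finset.mem_Ico] at hg
      exact card_farFiber_of_lt (by omega) (by omega)
    have hhigh : ∑ g ∈ Finset.Ico (2 ^ (n + 1) + 1) (2 ^ (n + 2)), (farFiber (2 ^ (n + 2)) g).card +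
        ∑ g ∈ Finset.Ico (2 ^ (n + 1) + 1) (2 ^ (n + 2)), g % 2 =
        ∑ g ∈ Finset.Ico (2 ^ (n + 1) + 1) (2 ^ (n + 2)), (2 ^ (n + 2) - g) := by
      rw [← Finset.sum_add_distrib]
      refine Finset.sum_congr rfl fun g hg => ?_
      rw [Finset.mem_Ico] at hg
      exact card_farFiber_of_gt (by omega) (by omega)
    have hmid := card_farFiber_of_eq (n := n + 2) (g := 2 ^ (n + 1)) (by positivity) hpow.symm
    have s1 := split fun g => (farFiber (2 ^ (n + 2)) g).card
    have s2 := split fun g => g % 2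
    have s3 := split fun g => 2 ^ (n + 2) - g
    have hm : ∑ g ∈ Finset.Ico 1 (2 ^ (n + 2)), g % 2 = 2 ^ (n + 1) := sum_mod_two (n + 1)
    have hs := sum_Ico_sub (2 ^ (n + 2))
    have hl := sum_lowBit (n + 1)
    beta_reduce at s1 s2 s3
    have hmod : 2 ^ (n + 1) % 2 = 0 := by omega
    rw [hmid] at s1
    rw [hmod] at s2
    have hP : 2 ^ (n + 2) * (2 ^ (n + 2) - 1) + 2 ^ (n + 2) = 2 ^ (n + 2) * 2 ^ (n + 2) := by
      rw [← Nat.mul_succ]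
      congr 1
      omega
    have e1 : 2 ^ (n + 2) * 2 ^ (n + 2) = 2 * (2 ^ (n + 2) * 2 ^ (n + 1)) := by
      rw [hpow]; ring
    have e2 : 2 ^ (n + 2) * (n + 1 + 1) = 2 * ((n + 1) * 2 ^ (n + 1)) + 2 * 2 ^ (n + 1) := by
      rw [hpow]; ring
    change ∑ g ∈ Finset.Ico 1 (2 ^ (n + 2)), (farFiber (2 ^ (n + 2)) g).card + 2 ^ (n + 2) * (n + 1 + 1) = 2 ^ (n + 2) * 2 ^ (n + 1)
    rw [e2]
    generalize 2 ^ (n + 2) * 2 ^ (n + 1) = X at *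
    generalize (n + 1) * 2 ^ (n + 1) = Y at *
    omega

/-! ### Closed forms and surjections -/

/-- Solves the two recurrences from exponent `1`, where both counts vanish because three positive
integers cannot sum to `2`. -/
theorem card_far_unfit (n : ℕ) :
    2 * ((farTriples (n + 1)).card : ℤ) =
        4 ^ (n + 1) + 12 * 2 ^ (n + 1) - 6 * (n + 1) * 2 ^ (n + 1) - 16 ∧
      2 * ((unfitTriples (n + 1)).card : ℤ) =
        4 ^ (n + 1) - 8 * 3 ^ (n + 1) + 6 * (n + 1) * 2 ^ (n + 1) + 8 := by
  induction n with
  | zero =>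
    have h1 : farTriples 1 = ∅ := by
      refine Finset.eq_empty_of_forall_notMem fun t ht => ?_
      have := pos_of_mem_farTriples ht
      have := (mem_farTriples.1 ht).1
      omega
    have h2 : unfitTriples 1 = ∅ := by
      refine Finset.eq_empty_of_forall_notMem fun t ht => ?_
      have := pos_of_mem_unfitTriples ht
      have := (mem_unfitTriples.1 ht).1
      omega
    simp [h1, h2]
  | succ n ih =>
    obtain ⟨h1, h2⟩ := ih
    have h3 := card_oddTriples_succ n
    have h4 : ((oddTriples (n + 1)).card : ℤ) + 2 ^ (n + 1) * (n + 1) = 2 ^ (n + 1) * 2 ^ n := by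
      exact_mod_cast h3
    have e4 : (4 : ℤ) ^ (n + 1) = 2 * (2 ^ (n + 1) * 2 ^ n) := by
      rw [show (4 : ℤ) = 2 ^ 2 by norm_num, ← pow_mul]
      ring
    constructor
    · rw [card_farTriples_succ]
      push_cast
      rw [pow_succ 4 (n + 1), pow_succ 2 (n + 1)]
      linarith
    · rw [card_unfitTriples_succ]
      push_cast
      rw [pow_succ 4 (n + 1), pow_succ 2 (n + 1), pow_succ 3 (n + 1)]
      linarith

/-- Inclusion–exclusion over the set of missed values: the functions avoiding a given `t` number `(k
- t.card) ^ n`. -/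
lemma card_surjective_eq_sum (n k : ℕ) :
    (Nat.card {f : Fin n → Fin k // Function.Surjective f} : ℤ) =
      ∑ m ∈ Finset.range (k + 1), k.choose m • ((-1) ^ m * ((k - m : ℕ) : ℤ) ^ n) := by
  classical
  have h := Finset.inclusion_exclusion_card_inf_compl (Finset.univ : Finset (Fin k))
    (fun i => (Finset.univ.filter fun f : Fin n → Fin k => ∀ x, f x ≠ i))
  have hl : (Finset.univ : Finset (Fin k)).inf
      (fun i => (Finset.univ.filter fun f : Fin n → Fin k => ∀ x, f x ≠ i)ᶜ) =
      Finset.univ.filter fun f : Fin n → Fin k => Function.Surjective f := by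
    ext f
    simp only [Finset.mem_inf, Finset.mem_univ, Finset.mem_compl, Finset.mem_filter, true_and,
      forall_const, not_forall, not_not]
    exact Iff.rfl
  have hr : ∀ t : Finset (Fin k), (t.inf
      (fun i => (Finset.univ.filter fun f : Fin n → Fin k => ∀ x, f x ≠ i))).card =
      (k - t.card) ^ n := by
    intro t
    have : t.inf (fun i => (Finset.univ.filter fun f : Fin n → Fin k => ∀ x, f x ≠ i)) =
        Fintype.piFinset fun _ => tᶜ := by
      ext f
      simp only [Finset.mem_inf, Finset.mem_filter, Finset.mem_univ, true_and,
        Fintype.mem_piFinset, Finset.mem_compl]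
      exact ⟨fun h x hx => h _ hx x rfl, fun h i hi x hx => h x (hx ▸ hi)⟩
    rw [this, Fintype.card_piFinset]
    simp [Finset.card_compl]
  rw [hl] at h
  rw [Nat.card_eq_fintype_card, Fintype.card_subtype, h]
  simp only [hr]
  push_cast
  rw [Finset.sum_powerset_apply_card (fun m => (-1 : ℤ) ^ m * ((k - m : ℕ) : ℤ) ^ n)]
  simp

theorem mainTheorem2 (n : ℕ) (hn : 4 ≤ n) :
    (unfitCount n : ℤ) =
        4 ^ n - (Nat.choose 4 3 : ℤ) * 3 ^ n + (Nat.choose 4 2 : ℤ) * 2 ^ n - (Nat.choose 4 1 : ℤ) ∧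
      unfitCount n = Nat.card {f : Fin n → Fin 4 // Function.Surjective f} := by
  have c1 : Nat.choose 4 1 = 4 := rfl
  have c2 : Nat.choose 4 2 = 6 := rfl
  have c3 : Nat.choose 4 3 = 4 := rfl
  have h : (unfitCount n : ℤ) = 4 ^ n - (Nat.choose 4 3 : ℤ) * 3 ^ n +
      (Nat.choose 4 2 : ℤ) * 2 ^ n - (Nat.choose 4 1 : ℤ) := by
    obtain ⟨m, rfl⟩ := Nat.exists_eq_add_of_lt (show 0 < n by omega)
    rw [zero_add, unfitCount_eq, c1, c2, c3]
    obtain ⟨h1, h2⟩ := card_far_unfit m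
    push_cast
    linarith
  refine ⟨h, ?_⟩
  have hz : (unfitCount n : ℤ) = Nat.card {f : Fin n → Fin 4 // Function.Surjective f} := by
    rw [h, card_surjective_eq_sum, c1, c2, c3]
    simp only [Finset.sum_range_succ, Finset.sum_range_zero, c1, c2, c3, Nat.choose_zero_right,
      Nat.choose_self]
    -- The last inclusion–exclusion term is `0 ^ n`, which vanishes because `n` is positive.
    have h0 : ((4 - 4 : ℕ) : ℤ) ^ n = 0 := by simp; omega
    rw [h0]
    norm_num
    ring
  exact_mod_cast hz
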